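/- For a finite set $S\subset\mathbb{R}^d$ (with the Euclidean metric), let $R(S)$ be the Vietoris–Rips complex of $S$ at scale $1$, that is, the simplicial complex whose faces are the subsets of $S$ of diameter at most $1$. For a field $\mathbf{k}$, let $\tilde\beta_p(R(S);\mathbf{k})=\dim_{\mathbf{k}}\tilde H_p(R(S);\mathbf{k})$ be its reduced Betti numbers (dimensions of reduced simplicial homology), and put $$M_{p,d}(n)=\max\{\tilde\beta_p(R(S);\mathbf{k}) : S\subset\mathbb{R}^d,\ |S|\le n\}.$$ Then there exists a constant $D$, independent of $n$ and of the field $\mathbf{k}$, such that $M_{2,2}(n)\le Dn$ for all integers $n\ge 0$. -/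

import Mathlib

set_option maxSynthPendingDepth 3

namespace RipsBetti

section Homology

variable (k : Type*) [Field k] {V : Type*}

/-- The chains of the augmented complex of `K` on faces with `m` vertices, that is, of
dimension `m - 1`; the empty set counts as a face with no vertex. -/
def chains (K : PreAbstractSimplicialComplex V) (m : ℕ) : Submodule k (Finset V →₀ k) :=
  Finsupp.supported k k {σ | σ.card = m ∧ (σ ∈ K ∨ σ = ∅)}

/-- If all faces of `K` are subsets of a finite set `S`, then its chain spaces are finite
dimensional. -/
theorem chains_finite (K : PreAbstractSimplicialComplex V) (S : Finset V)
    (hK : ∀ σ ∈ K, σ ⊆ S) (m : ℕ) :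
    Module.Finite k (chains k K m) ∧ Module.finrank k (chains k K m) ≤ 2 ^ S.card := by
  have hsub : {σ : Finset V | σ.card = m ∧ (σ ∈ K ∨ σ = ∅)} ⊆ (S.powerset : Set (Finset V)) := by
    rintro σ ⟨_, h | h⟩
    · simpa using hK σ h
    · simp [h]
  have hfin := S.powerset.finite_toSet.subset hsub
  have : Fintype {σ : Finset V | σ.card = m ∧ (σ ∈ K ∨ σ = ∅)} := hfin.fintype
  let e := Finsupp.supportedEquivFinsupp (M := k) (R := k)
    {σ : Finset V | σ.card = m ∧ (σ ∈ K ∨ σ = ∅)}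
  refine ⟨Module.Finite.equiv e.symm, ?_⟩
  have h1 : Module.finrank k (chains k K m) =
      Fintype.card {σ : Finset V | σ.card = m ∧ (σ ∈ K ∨ σ = ∅)} := by
    rw [chains, e.finrank_eq, Module.finrank_finsupp_self]
  rw [h1, ← Finset.card_powerset, ← Set.toFinset_card]
  exact Finset.card_le_card fun σ hσ => hsub (Set.mem_toFinset.1 hσ)

variable [LinearOrder V]

/-- The simplicial boundary map with coefficients in `k`, on formal combinations of finite subsets
of a linearly ordered vertex set: a set `σ = {v₀ < v₁ < ⋯ < vₘ}` is sent to
`∑ i, (-1) ^ i • (σ \ {vᵢ})`. The exponent of the sign is the number of elements of `σ` that lie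
below the removed vertex. Single vertices are sent to the empty set (the augmentation). -/
noncomputable def boundary : (Finset V →₀ k) →ₗ[k] (Finset V →₀ k) :=
  Finsupp.linearCombination k fun σ : Finset V =>
    ∑ v ∈ σ, Finsupp.single (σ.erase v) ((-1 : k) ^ (σ.filter (· < v)).card)

/-- The reduced `p`-cycles. -/
noncomputable def cycles (K : PreAbstractSimplicialComplex V) (p : ℕ) :
    Submodule k (Finset V →₀ k) :=
  chains k K (p + 1) ⊓ LinearMap.ker (boundary k)

/-- The `p`-boundaries. -/
noncomputable def boundaries (K : PreAbstractSimplicialComplex V) (p : ℕ) :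
    Submodule k (Finset V →₀ k) :=
  (chains k K (p + 2)).map (boundary k)

/-- The reduced simplicial homology `H̃_p(K; k)`, cycles modulo boundaries. -/
abbrev reducedHomology (K : PreAbstractSimplicialComplex V) (p : ℕ) : Type _ :=
  cycles k K p ⧸ (boundaries k K p).submoduleOf (cycles k K p)

/-- The reduced Betti number `β̃_p(K; k) = dim H̃_p(K; k)`. -/
noncomputable def betti (K : PreAbstractSimplicialComplex V) (p : ℕ) : ℕ :=
  Module.finrank k (reducedHomology k K p)

theorem boundary_single (σ : Finset V) (a : k) :
    boundary k (Finsupp.single σ a) =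
      a • ∑ v ∈ σ, Finsupp.single (σ.erase v) ((-1 : k) ^ (σ.filter (· < v)).card) := by
  simp [boundary]

/-- The boundary of a boundary vanishes. -/
theorem boundary_boundary (c : Finset V →₀ k) : boundary k (boundary k c) = 0 := by
  suffices h : (boundary k).comp (boundary k) = (0 : (Finset V →₀ k) →ₗ[k] (Finset V →₀ k)) from
    LinearMap.congr_fun h c
  ext1 σ
  ext1
  simp only [LinearMap.comp_apply, Finsupp.lsingle_apply, boundary_single, one_smul, map_sum,
    LinearMap.zero_apply, Finset.smul_sum, Finsupp.smul_single, smul_eq_mul]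
  rw [Finset.sum_sigma']
  refine Finset.sum_involution (fun x _ => ⟨x.2, x.1⟩) ?_ ?_ ?_ ?_
  · rintro ⟨v, w⟩ hx
    obtain ⟨hv, hw⟩ := Finset.mem_sigma.1 hx
    obtain ⟨hwv, hw⟩ := Finset.mem_erase.1 hw
    simp only at hv hw hwv ⊢
    rw [Finset.erase_right_comm, ← Finsupp.single_add]
    have key : ∀ a b : V, a ∈ σ → b ∈ σ → a < b →
        (-1 : k) ^ (σ.filter (· < a)).card * (-1) ^ ((σ.erase a).filter (· < b)).card +
          (-1) ^ (σ.filter (· < b)).card * (-1) ^ ((σ.erase b).filter (· < a)).card = 0 := by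
      intro a b ha hb hab
      have h1 : (σ.erase b).filter (· < a) = σ.filter (· < a) := by
        ext z; simp only [Finset.mem_filter, Finset.mem_erase]; grind
      have h2 : (σ.erase a).filter (· < b) = (σ.filter (· < b)).erase a := by
        ext z; simp only [Finset.mem_filter, Finset.mem_erase]; grind
      have h3 : ((σ.filter (· < b)).erase a).card + 1 = (σ.filter (· < b)).card :=
        Finset.card_erase_add_one (by simp [ha, hab])
      rw [h1, h2, ← h3]
      ring
    rcases lt_or_gt_of_ne hwv with h | h
    · rw [add_comm, key w v hw hv h, Finsupp.single_zero]
    · rw [key v w hv hw h, Finsupp.single_zero]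
  · rintro ⟨v, w⟩ hx _ h
    obtain ⟨_, hw⟩ := Finset.mem_sigma.1 hx
    have := congrArg Sigma.fst h
    exact (Finset.mem_erase.1 hw).1 this
  · rintro ⟨v, w⟩ hx
    simp only [Finset.mem_sigma, Finset.mem_erase] at hx ⊢
    exact ⟨hx.2.2, fun h => hx.2.1 h.symm, hx.1⟩
  · intro x _; rfl

/-- The boundary of a chain on faces with `m + 1` vertices is a chain on faces with `m`
vertices. -/
theorem boundary_mem_chains (K : PreAbstractSimplicialComplex V) {m : ℕ} {c : Finset V →₀ k}
    (hc : c ∈ chains k K (m + 1)) : boundary k c ∈ chains k K m := by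
  rw [boundary, Finsupp.linearCombination_apply]
  refine Submodule.sum_mem _ fun σ hσ => Submodule.smul_mem _ _ (Submodule.sum_mem _ fun v hv => ?_)
  obtain ⟨h1, h2⟩ := (Finsupp.mem_supported k c).1 hc hσ
  refine Finsupp.single_mem_supported k _ ⟨?_, ?_⟩
  · rw [Finset.card_erase_of_mem hv, h1]; rfl
  · rcases (σ.erase v).eq_empty_or_nonempty with h | h
    · exact Or.inr h
    · rcases h2 with h2 | h2
      · exact Or.inl ((K.isRelLowerSet_faces h2).2 (Finset.erase_subset v σ) h)
      · simp [h2] at hv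

theorem boundaries_le_cycles (K : PreAbstractSimplicialComplex V) (p : ℕ) :
    boundaries k K p ≤ cycles k K p := by
  rintro _ ⟨c, hc, rfl⟩
  exact ⟨boundary_mem_chains k K hc, boundary_boundary k c⟩

theorem reducedHomology_finite (K : PreAbstractSimplicialComplex V) (S : Finset V)
    (hK : ∀ σ ∈ K, σ ⊆ S) (p : ℕ) : Module.Finite k (reducedHomology k K p) := by
  have := (chains_finite k K S hK (p + 1)).1
  have : Module.Finite k (cycles k K p) := Submodule.finiteDimensional_of_le inf_le_left
  infer_instance

theorem betti_le (K : PreAbstractSimplicialComplex V) (S : Finset V)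
    (hK : ∀ σ ∈ K, σ ⊆ S) (p : ℕ) : betti k K p ≤ 2 ^ S.card := by
  have := (chains_finite k K S hK (p + 1)).1
  have hle : cycles k K p ≤ chains k K (p + 1) := inf_le_left
  have : Module.Finite k (cycles k K p) := Submodule.finiteDimensional_of_le hle
  exact ((Submodule.finrank_quotient_le _).trans (Submodule.finrank_mono hle)).trans
    (chains_finite k K S hK (p + 1)).2

end Homology

/-- The Vietoris–Rips complex `R^ε(S)`: its faces are the nonempty subsets of `S` with diameter at
most `ε`. -/
def ripsComplex {V : Type*} [PseudoMetricSpace V] (ε : ℝ) (S : Finset V) :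
    PreAbstractSimplicialComplex V where
  faces := {σ | σ.Nonempty ∧ σ ⊆ S ∧ Metric.diam (σ : Set V) ≤ ε}
  isRelLowerSet_faces := by
    rintro σ ⟨hne, hS, hd⟩
    refine ⟨hne, fun τ hτ hτne => ⟨hτne, hτ.trans hS, ?_⟩⟩
    exact (Metric.diam_mono (Finset.coe_subset.2 hτ) σ.finite_toSet.isBounded).trans hd

/-- The lexicographic order of `ℝ^d`; it serves only to fix orientations of the simplices. -/
noncomputable instance lexOrder (d : ℕ) : LinearOrder (EuclideanSpace ℝ (Fin d)) :=
  LinearOrder.lift' (fun x => toLex (WithLp.ofLp x))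
    (toLex.injective.comp (WithLp.ofLp_injective 2))

/-- The numbers `β̃_p(R(S); k)` for `S ⊆ ℝ^d` with at most `n` points, where `R(S) = R^1(S)`. -/
def ripsBettiNumbers (k : Type*) [Field k] (p d n : ℕ) : Set ℕ :=
  {b | ∃ S : Finset (EuclideanSpace ℝ (Fin d)), S.card ≤ n ∧ b = betti k (ripsComplex 1 S) p}

/-- `M_{p,d}(n)`, the maximum of `β̃_p(R(S); k)` over all `S ⊆ ℝ^d` with at most `n` points. -/
noncomputable def maxBetti (k : Type*) [Field k] (p d n : ℕ) : ℕ :=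
  sSup (ripsBettiNumbers k p d n)

/-- The supremum that defines `maxBetti` is a maximum. -/
theorem isGreatest_maxBetti (k : Type*) [Field k] (p d n : ℕ) :
    IsGreatest (ripsBettiNumbers k p d n) (maxBetti k p d n) := by
  have hne : (ripsBettiNumbers k p d n).Nonempty := ⟨_, ∅, by simp, rfl⟩
  have hbdd : BddAbove (ripsBettiNumbers k p d n) := by
    refine ⟨2 ^ n, ?_⟩
    rintro _ ⟨S, hS, rfl⟩
    exact (betti_le k _ S (fun σ (hσ : σ ∈ ripsComplex 1 S) => hσ.2.1) p).trans (Nat.pow_le_pow_right (by norm_num) hS)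
  exact ⟨Nat.sSup_mem hne hbdd, fun b hb => le_csSup hbdd hb⟩

end RipsBetti

/-!
The plane is cut into small squares, the cells, so that points in the same cell are adjacent. In the
filtration of the Rips complex by the number of cells that a simplex meets, second homology comes
from triangles that meet three cells and from pairs of cells (`codimLE_of_cells`). Simplices inside
one cell contribute nothing, and tetrahedra on four cells only add boundaries. Every point is close
to boundedly many cells only. So it is enough to bound the contribution of every triple and every
pair of cells by a multiple of the number of points in these cells.

Three cells. Moving one vertex of a triangle inside its cell changes the triangle, up to sign, by a
boundary and triangles that meet two cells, so only the classes of triangles under such moves count.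
By an estimate in the plane (`not_both_farther`), a triangle `abc` with `a` in the first cell cannot
have both a triangle of another class with the vertex `c` and its first vertex farther from `c`, and
a triangle of another class with the vertex `b` and its first vertex farther from `b`, unless the
cells of `b` and `c` are completely joined. Hence every class can be charged to a vertex of its own
(`card_le_of_inequivalent`).

Two cells. If the points of both cells are ordered by their height orthogonally to the direction
between the cells, then adjacency has no crossings (`exists_noCrossing`): if the diagonals of a
quadrilateral have length at most `1`, then so has one of any two opposite sides. The points `a` of
the first cell are added one after the other. Each of them adds at most the first Betti number of
its link (`codimLE_insert`). The link consists of two cliques, so a nonzero number of classes of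
edges between them exceeds this Betti number by at least one (`codimLE_two_cells`). Hence the latter
is at most the number of gaps, pairs of consecutive old neighbors of `a` in the second cell that are
not yet connected, where a neighbor of `a` is old if it is adjacent to a point added before `a`. A
gap with a new neighbor of `a` in between is charged to that neighbor. As adjacency has no
crossings, the intervals spanned by the remaining gaps do not cross each other, and so the number of
gaps is linear in the number of points of the second cell (`sum_card_gaps_le`).
-/

namespace RipsBetti

/-! ### Dimension modulo a subspace -/

section Codim

variable {k E F : Type*} [Field k] [AddCommGroup E] [Module k E] [AddCommGroup F] [Module k F]

/-- `CodimLE N Z B` says that `Z` has dimension at most `N` modulo `B`: a space of dimension at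
most `N` together with `B` spans `Z`. The space `B` is not required to lie in `Z`. -/
def CodimLE (N : ℕ) (Z B : Submodule k E) : Prop :=
  ∃ R : Submodule k E, Module.Finite k R ∧ Module.finrank k R ≤ N ∧ Z ≤ R ⊔ B

theorem CodimLE.of_le {Z B : Submodule k E} (h : Z ≤ B) (N : ℕ) : CodimLE N Z B :=
  ⟨⊥, inferInstance, by simp, by simpa using h⟩

theorem CodimLE.mono {M N : ℕ} {Z Z' B B' : Submodule k E} (h : CodimLE M Z B) (hN : M ≤ N)
    (hZ : Z' ≤ Z) (hB : B ≤ B') : CodimLE N Z' B' := by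
  obtain ⟨R, hR, hM, hZR⟩ := h
  exact ⟨R, hR, hM.trans hN, hZ.trans (hZR.trans (sup_le_sup_left hB R))⟩

theorem CodimLE.sup {M N : ℕ} {Z Z' B : Submodule k E} (h : CodimLE M Z B)
    (h' : CodimLE N Z' B) : CodimLE (M + N) (Z ⊔ Z') B := by
  obtain ⟨R, hR, hM, hZR⟩ := h
  obtain ⟨R', hR', hN, hZR'⟩ := h'
  refine ⟨R ⊔ R', inferInstance, (Submodule.finrank_add_le_finrank_add_finrank R R').trans
    (add_le_add hM hN), sup_le (hZR.trans ?_) (hZR'.trans ?_)⟩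
  · exact sup_le_sup_right le_sup_left B
  · exact sup_le_sup_right le_sup_right B

theorem CodimLE.trans {M N : ℕ} {Z W B : Submodule k E} (h : CodimLE M Z W)
    (h' : CodimLE N W B) : CodimLE (M + N) Z B := by
  obtain ⟨R, hR, hM, hZR⟩ := h
  obtain ⟨R', hR', hN, hWR'⟩ := h'
  refine ⟨R ⊔ R', inferInstance, (Submodule.finrank_add_le_finrank_add_finrank R R').trans
    (add_le_add hM hN), hZR.trans ?_⟩
  rw [sup_assoc]
  exact sup_le_sup_left hWR' R

theorem CodimLE.biSup {ι : Type*} (I : Finset ι) (N : ι → ℕ) (Z : ι → Submodule k E)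
    (B : Submodule k E) (h : ∀ i ∈ I, CodimLE (N i) (Z i) B) :
    CodimLE (∑ i ∈ I, N i) (⨆ i ∈ I, Z i) B := by
  classical
  induction I using Finset.induction_on with
  | empty => exact CodimLE.of_le (by simp) _
  | insert i I hi ih =>
    rw [Finset.sum_insert hi, Finset.iSup_insert]
    exact (h i (Finset.mem_insert_self i I)).sup
      (ih fun j hj => h j (Finset.mem_insert_of_mem hj))

/-- The spanning space is finite dimensional, so the image in the quotient is as well. -/
theorem CodimLE.map_mkQ {N : ℕ} {Z B : Submodule k E} (h : CodimLE N Z B) :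
    Module.Finite k (Z.map B.mkQ) ∧ Module.finrank k (Z.map B.mkQ) ≤ N := by
  obtain ⟨R, hR, hN, hZ⟩ := h
  have hle : Z.map B.mkQ ≤ R.map B.mkQ := by
    refine (Submodule.map_mono hZ).trans ?_
    rw [Submodule.map_sup, Submodule.mkQ_map_self, sup_bot_eq]
  exact ⟨Submodule.finiteDimensional_of_le hle,
    (Submodule.finrank_mono hle).trans ((Submodule.finrank_map_le _ R).trans hN)⟩

/-- If `f` maps `Z` to `Z'`, then the dimension of `Z` modulo the preimage of `B'` is at most that
of `Z'` modulo `B'`. -/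
theorem CodimLE.comap {N : ℕ} {Z : Submodule k E} {Z' B' : Submodule k F} (f : E →ₗ[k] F)
    (hf : ∀ z ∈ Z, f z ∈ Z') (h : CodimLE N Z' B') : CodimLE N Z (Z ⊓ B'.comap f) := by
  obtain ⟨hfin, hN⟩ := h.map_mkQ
  let g : Z →ₗ[k] F ⧸ B' := B'.mkQ ∘ₗ f ∘ₗ Z.subtype
  have hg : LinearMap.range g ≤ Z'.map B'.mkQ := by
    rintro _ ⟨z, rfl⟩
    exact ⟨f z, hf z z.2, rfl⟩
  have hgfin : Module.Finite k (LinearMap.range g) := Submodule.finiteDimensional_of_le hg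
  obtain ⟨Q, hQ⟩ := Submodule.exists_isCompl (LinearMap.ker g)
  let e : Q ≃ₗ[k] LinearMap.range g :=
    (Submodule.quotientEquivOfIsCompl _ _ hQ).symm.trans g.quotKerEquivRange
  have : Module.Finite k Q := Module.Finite.equiv e.symm
  refine ⟨Q.map Z.subtype, inferInstance, ?_, ?_⟩
  · refine (Submodule.finrank_map_le _ Q).trans ?_
    rw [e.finrank_eq]
    exact (Submodule.finrank_mono hg).trans hN
  · intro z hz
    have hz' : (⟨z, hz⟩ : Z) ∈ LinearMap.ker g ⊔ Q := by rw [hQ.sup_eq_top]; trivial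
    obtain ⟨x, hx, y, hy, hxy⟩ := Submodule.mem_sup.1 hz'
    have hx' : B'.mkQ (f x) = 0 := hx
    rw [Submodule.mkQ_apply, Submodule.Quotient.mk_eq_zero] at hx'
    have hxy' : (x : E) + y = z := congrArg Subtype.val hxy
    rw [← hxy', add_comm]
    exact Submodule.add_mem_sup ⟨y, hy, rfl⟩ ⟨x.2, hx'⟩

theorem CodimLE.inf {N : ℕ} {Z W : Submodule k E} (h : CodimLE N Z W) : CodimLE N Z (Z ⊓ W) :=
  CodimLE.comap LinearMap.id (fun _ hz => hz) h

end Codim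

/-! ### Chains, boundaries and cones -/

section Chains

variable {k : Type*} [Field k] {V : Type*}

theorem map_mem_of_supported {M α : Type*} [AddCommGroup M] [Module k M] {F : Set α}
    {X : Submodule k M} (f : (α →₀ k) →ₗ[k] M) (h : ∀ σ ∈ F, f (Finsupp.single σ 1) ∈ X)
    {z : α →₀ k} (hz : z ∈ Finsupp.supported k k F) : f z ∈ X := by
  rw [Finsupp.supported_eq_span_single] at hz
  suffices Submodule.span k ((fun i => Finsupp.single i (1 : k)) '' F) ≤ X.comap f from this hz
  rw [Submodule.span_le]
  rintro _ ⟨σ, hσ, rfl⟩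
  exact h σ hσ

theorem mem_of_supported {α : Type*} {F : Set α} {X : Submodule k (α →₀ k)}
    (h : ∀ σ ∈ F, Finsupp.single σ 1 ∈ X) {z : α →₀ k}
    (hz : z ∈ Finsupp.supported k k F) : z ∈ X :=
  map_mem_of_supported LinearMap.id h hz

theorem eq_of_supported {M α : Type*} [AddCommGroup M] [Module k M] {F : Set α}
    (f g : (α →₀ k) →ₗ[k] M) (h : ∀ σ ∈ F, f (Finsupp.single σ 1) = g (Finsupp.single σ 1))
    {z : α →₀ k} (hz : z ∈ Finsupp.supported k k F) : f z = g z := by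
  have := map_mem_of_supported (X := ⊥) (f - g)
    (fun σ hσ => by simp [h σ hσ]) hz
  rwa [Submodule.mem_bot, LinearMap.sub_apply, sub_eq_zero] at this

open Classical in
/-- The part of a formal combination that is supported on the elements with the property `p`. -/
noncomputable def part {α : Type*} (p : α → Prop) : (α →₀ k) →ₗ[k] (α →₀ k) where
  toFun z := z.filter p
  map_add' _ _ := Finsupp.filter_add
  map_smul' _ _ := Finsupp.filter_smul

theorem part_apply {α : Type*} (p : α → Prop) (z : α →₀ k) (σ : α) [Decidable (p σ)] :
    part p z σ = if p σ then z σ else 0 := by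
  classical
  simp only [part, LinearMap.coe_mk, AddHom.coe_mk, Finsupp.filter_apply]
  split_ifs <;> rfl

theorem part_mem {α : Type*} {p : α → Prop} {F G : Set α} {z : α →₀ k}
    (hz : z ∈ Finsupp.supported k k F) (h : ∀ σ ∈ F, p σ → σ ∈ G) :
    part p z ∈ Finsupp.supported k k G := by
  classical
  rw [Finsupp.mem_supported'] at hz ⊢
  intro σ hσ
  rw [part_apply]
  split_ifs with hp
  · exact hz σ fun hF => hσ (h σ hF hp)
  · rfl

theorem part_eq_self {α : Type*} {p : α → Prop} {F : Set α} {z : α →₀ k}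
    (hz : z ∈ Finsupp.supported k k F) (h : ∀ σ ∈ F, p σ) : part p z = z := by
  classical
  rw [Finsupp.mem_supported'] at hz
  ext σ
  rw [part_apply]
  split_ifs with hp
  · rfl
  · exact (hz σ fun hF => hp (h σ hF)).symm

theorem part_eq_zero {α : Type*} {p : α → Prop} {F : Set α} {z : α →₀ k}
    (hz : z ∈ Finsupp.supported k k F) (h : ∀ σ ∈ F, ¬ p σ) : part p z = 0 := by
  classical
  rw [Finsupp.mem_supported'] at hz
  ext σ
  rw [part_apply]
  split_ifs with hp
  · exact hz σ fun hF => h σ hF hp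
  · rfl

theorem sub_part_mem {α : Type*} {p : α → Prop} {F G : Set α} {z : α →₀ k}
    (hz : z ∈ Finsupp.supported k k F) (h : ∀ σ ∈ F, ¬ p σ → σ ∈ G) :
    z - part p z ∈ Finsupp.supported k k G := by
  classical
  rw [Finsupp.mem_supported'] at hz ⊢
  intro σ hσ
  rw [Finsupp.sub_apply, part_apply]
  split_ifs with hp
  · exact sub_self _
  · rw [sub_zero]; exact hz σ fun hF => hσ (h σ hF hp)

variable [LinearOrder V]

theorem boundary_single_one (σ : Finset V) :
    boundary k (Finsupp.single σ 1) =
      ∑ v ∈ σ, Finsupp.single (σ.erase v) ((-1 : k) ^ (σ.filter (· < v)).card) := by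
  rw [boundary_single, one_smul]

theorem boundary_mem {F G : Set (Finset V)} {z : Finset V →₀ k}
    (hz : z ∈ Finsupp.supported k k F) (h : ∀ σ ∈ F, ∀ v ∈ σ, σ.erase v ∈ G) :
    boundary k z ∈ Finsupp.supported k k G := by
  refine map_mem_of_supported (boundary k) (fun σ hσ => ?_) hz
  rw [boundary_single_one]
  exact Submodule.sum_mem _ fun v hv => Finsupp.single_mem_supported k _ (h σ hσ v hv)

/-- The cone operator with apex `v`: a set `σ` that does not contain `v` is sent to `σ ∪ {v}`, with
the sign that makes `σ` occur with coefficient `1` in its boundary; the other sets are sent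
to `0`. -/
noncomputable def cone (v : V) : (Finset V →₀ k) →ₗ[k] (Finset V →₀ k) :=
  Finsupp.linearCombination k fun σ : Finset V =>
    if v ∈ σ then 0 else Finsupp.single (insert v σ) ((-1 : k) ^ (σ.filter (· < v)).card)

theorem cone_single_of_mem {v : V} {σ : Finset V} (h : v ∈ σ) (a : k) :
    cone v (Finsupp.single σ a) = 0 := by
  simp [cone, h]

theorem cone_single_of_notMem {v : V} {σ : Finset V} (h : v ∉ σ) (a : k) :
    cone v (Finsupp.single σ a) =
      Finsupp.single (insert v σ) (a * (-1 : k) ^ (σ.filter (· < v)).card) := by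
  simp [cone, h]

theorem cone_mem {F G : Set (Finset V)} {v : V} {z : Finset V →₀ k}
    (hz : z ∈ Finsupp.supported k k F) (h : ∀ σ ∈ F, v ∉ σ → insert v σ ∈ G) :
    cone v z ∈ Finsupp.supported k k G := by
  refine map_mem_of_supported (cone v) (fun σ hσ => ?_) hz
  by_cases hv : v ∈ σ
  · rw [cone_single_of_mem hv]; exact Submodule.zero_mem _
  · rw [cone_single_of_notMem hv]
    exact Finsupp.single_mem_supported k _ (h σ hσ hv)

/-- Taking the cone is a contracting homotopy of the augmented complex of the full simplex. -/
theorem boundary_cone (v : V) (z : Finset V →₀ k) :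
    boundary k (cone v z) + cone v (boundary k z) = z := by
  suffices h : (boundary k) ∘ₗ (cone v) + (cone v) ∘ₗ (boundary k) =
      (LinearMap.id : (Finset V →₀ k) →ₗ[k] (Finset V →₀ k)) from LinearMap.congr_fun h z
  refine Finsupp.lhom_ext' fun σ => LinearMap.ext_ring ?_
  simp only [LinearMap.comp_apply, Finsupp.lsingle_apply, LinearMap.add_apply, LinearMap.id_apply,
    boundary_single_one, map_sum]
  have hsq : ∀ n : ℕ, (-1 : k) ^ n * (-1 : k) ^ n = 1 := fun n => by
    rw [← mul_pow]; simp
  by_cases hv : v ∈ σ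
  · rw [cone_single_of_mem hv, map_zero, zero_add, ← Finset.add_sum_erase σ _ hv,
      cone_single_of_notMem (Finset.notMem_erase v σ), Finset.insert_erase hv]
    have h1 : (σ.erase v).filter (· < v) = σ.filter (· < v) := by
      ext z; simp only [Finset.mem_filter, Finset.mem_erase]; grind
    rw [h1, hsq, Finset.sum_eq_zero, add_zero]
    intro w hw
    obtain ⟨hwv, hw⟩ := Finset.mem_erase.1 hw
    exact cone_single_of_mem (Finset.mem_erase.2 ⟨hwv.symm, hv⟩) _
  · rw [cone_single_of_notMem hv, one_mul, boundary_single, Finset.sum_insert hv, smul_add,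
      Finset.erase_insert hv]
    have h1 : (insert v σ).filter (· < v) = σ.filter (· < v) := by
      ext z; simp only [Finset.mem_filter, Finset.mem_insert]; grind
    rw [h1, Finsupp.smul_single, smul_eq_mul, hsq, add_assoc, Finset.smul_sum,
      ← Finset.sum_add_distrib, Finset.sum_eq_zero, add_zero]
    intro w hw
    have hwv : w ≠ v := fun h => hv (h ▸ hw)
    have hv' : v ∉ σ.erase w := fun h => hv (Finset.mem_of_mem_erase h)
    rw [cone_single_of_notMem hv', Finset.erase_insert_of_ne hwv.symm, Finsupp.smul_single,
      smul_eq_mul, ← Finsupp.single_add]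
    refine (congrArg _ ?_).trans (Finsupp.single_zero _)
    rcases lt_or_gt_of_ne hwv with h | h
    · have h2 : (insert v σ).filter (· < w) = σ.filter (· < w) := by
        ext z; simp only [Finset.mem_filter, Finset.mem_insert]; grind
      have h3 : (σ.erase w).filter (· < v) = (σ.filter (· < v)).erase w := by
        ext z; simp only [Finset.mem_filter, Finset.mem_erase]; grind
      have h4 : ((σ.filter (· < v)).erase w).card + 1 = (σ.filter (· < v)).card :=
        Finset.card_erase_add_one (by simp [hw, h])
      rw [h2, h3, ← h4]
      ring
    · have h2 : (insert v σ).filter (· < w) = insert v (σ.filter (· < w)) := by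
        ext z; simp only [Finset.mem_filter, Finset.mem_insert]; grind
      have h3 : (σ.erase w).filter (· < v) = σ.filter (· < v) := by
        ext z; simp only [Finset.mem_filter, Finset.mem_erase]; grind
      rw [h2, h3, Finset.card_insert_of_notMem (by simp [hv])]
      ring

end Chains

/-! ### Flag complexes and swaps of vertices in a cell -/

section Flag

variable {k : Type*} [Field k] {V : Type*}

/-- The flag complex of the relation `r` on the vertex set `S`: its faces are the nonempty subsets
of `S` whose elements are pairwise related. -/
def flag (r : V → V → Prop) (S : Finset V) : PreAbstractSimplicialComplex V where
  faces := {σ | σ.Nonempty ∧ σ ⊆ S ∧ ∀ u ∈ σ, ∀ v ∈ σ, r u v}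
  isRelLowerSet_faces := by
    rintro σ ⟨hne, hS, hr⟩
    exact ⟨hne, fun τ hτ hτne => ⟨hτne, hτ.trans hS, fun u hu v hv => hr u (hτ hu) v (hτ hv)⟩⟩

theorem flag_mono {r : V → V → Prop} {S S' σ : Finset V} (h : S ⊆ S') (hσ : σ ∈ flag r S) :
    σ ∈ flag r S' :=
  ⟨hσ.1, hσ.2.1.trans h, hσ.2.2⟩

theorem singleton_mem_flag {r : V → V → Prop} {S : Finset V} {v : V} (hv : v ∈ S) (h : r v v) :
    {v} ∈ flag r S := by
  refine ⟨Finset.singleton_nonempty v, Finset.singleton_subset_iff.2 hv, fun u hu w hw => ?_⟩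
  rw [Finset.mem_singleton.1 hu, Finset.mem_singleton.1 hw]
  exact h

theorem insert_mem_flag [DecidableEq V] {r : V → V → Prop} (hr : ∀ u v, r u v → r v u)
    {S S' σ : Finset V} (hσ : σ ∈ flag r S) (hS : S ⊆ S') {v : V} (hv : v ∈ S') (hvv : r v v)
    (h : ∀ u ∈ σ, r v u) : insert v σ ∈ flag r S' := by
  refine ⟨Finset.insert_nonempty v σ, Finset.insert_subset hv (hσ.2.1.trans hS),
    fun u hu w hw => ?_⟩
  rcases Finset.mem_insert.1 hu with huv | hu <;> rcases Finset.mem_insert.1 hw with hwv | hw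
  · rw [huv, hwv]; exact hvv
  · rw [huv]; exact h w hw
  · rw [hwv]; exact hr _ _ (h u hu)
  · exact hσ.2.2 u hu w hw

theorem mem_of_subset {K : PreAbstractSimplicialComplex V} {σ τ : Finset V} (h : σ ∈ K)
    (hτ : τ ⊆ σ) (hne : τ.Nonempty) : τ ∈ K := (K.isRelLowerSet_faces h).2 hτ hne

theorem chains_succ (K : PreAbstractSimplicialComplex V) (m : ℕ) :
    chains k K (m + 1) = Finsupp.supported k k {σ | σ.card = m + 1 ∧ σ ∈ K} := by
  unfold chains
  congr 1
  ext σ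
  constructor
  · rintro ⟨h, h' | h'⟩
    · exact ⟨h, h'⟩
    · simp [h'] at h
  · rintro ⟨h, h'⟩
    exact ⟨h, Or.inl h'⟩

theorem chains_mono {K L : PreAbstractSimplicialComplex V} (h : ∀ σ ∈ K, σ ∈ L) (m : ℕ) :
    chains k K m ≤ chains k L m :=
  Finsupp.supported_mono fun _ hσ => ⟨hσ.1, hσ.2.imp_left (h _)⟩

variable [LinearOrder V]

theorem boundaries_mono {K L : PreAbstractSimplicialComplex V} (h : ∀ σ ∈ K, σ ∈ L) (p : ℕ) :
    boundaries k K p ≤ boundaries k L p :=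
  Submodule.map_mono (chains_mono h _)

/-- If the cycles have dimension at most `N` modulo the boundaries, then the Betti number is at
most `N`. -/
theorem betti_le_of_codimLE {K : PreAbstractSimplicialComplex V} {p N : ℕ}
    (h : CodimLE N (cycles k K p) (boundaries k K p)) : betti k K p ≤ N := by
  obtain ⟨hfin, hN⟩ := h.map_mkQ
  let g : cycles k K p →ₗ[k] (Finset V →₀ k) ⧸ boundaries k K p :=
    (boundaries k K p).mkQ ∘ₗ (cycles k K p).subtype
  have hker : LinearMap.ker g = (boundaries k K p).submoduleOf (cycles k K p) := by
    ext z
    simp only [g, LinearMap.mem_ker, LinearMap.comp_apply, Submodule.subtype_apply,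
      Submodule.mkQ_apply, Submodule.Quotient.mk_eq_zero]
    exact Iff.rfl
  have hrange : LinearMap.range g = (cycles k K p).map (boundaries k K p).mkQ := by
    rw [LinearMap.range_comp, Submodule.range_subtype]
  unfold betti reducedHomology
  rw [← hker, g.quotKerEquivRange.finrank_eq, hrange]
  exact hN

variable {ι : Type*} (K : PreAbstractSimplicialComplex V) (κ : V → ι)

/-- Two `p`-faces are related if they arise from a `(p + 1)`-face by leaving out one of two of its
vertices that lie in the same cell, the cell of a vertex `v` being `κ v`. -/
def Swap (p : ℕ) (σ σ' : Finset V) : Prop :=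
  ∃ ρ ∈ K, ρ.card = p + 2 ∧ ∃ a ∈ ρ, ∃ a' ∈ ρ, a ≠ a' ∧ κ a = κ a' ∧
    σ = ρ.erase a ∧ σ' = ρ.erase a'

/-- The `p`-faces with two vertices in the same cell. -/
def nonrainbow (p : ℕ) : Set (Finset V) :=
  {σ | σ.card = p + 1 ∧ σ ∈ K ∧ ¬ Set.InjOn κ (σ : Set V)}

variable {K κ}

theorem Swap.symm {p : ℕ} {σ σ' : Finset V} (h : Swap K κ p σ σ') : Swap K κ p σ' σ := by
  obtain ⟨ρ, hρ, hc, a, ha, a', ha', hne, hκ, h, h'⟩ := h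
  exact ⟨ρ, hρ, hc, a', ha', a, ha, hne.symm, hκ.symm, h', h⟩

theorem eqvGen_insert [inst : DecidableEq V] {p : ℕ} {τ : Finset V} {u u' : V}
    (hτ : τ.card = p) (hu : u ∉ τ) (hu' : u' ∉ τ) (hκ : κ u = κ u')
    (h : insert u (insert u' τ) ∈ K) :
    Relation.EqvGen (Swap K κ p) (insert u τ) (insert u' τ) := by
  -- the sets `insert u τ` may be formed with any decision procedure for equality of vertices
  obtain rfl : inst = fun a b => LinearOrder.toDecidableEq a b := Subsingleton.elim _ _
  by_cases hne : u = u'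
  · rw [hne]; exact .refl _
  have hu1 : u ∉ insert u' τ := by simp [hne, hu]
  refine .rel _ _ ⟨_, h, ?_, u', by simp, u, by simp, Ne.symm hne, hκ.symm, ?_, ?_⟩
  · rw [Finset.card_insert_of_notMem hu1, Finset.card_insert_of_notMem hu', hτ]
  · rw [Finset.erase_insert_of_ne hne, Finset.erase_insert hu']
  · rw [Finset.erase_insert hu1]

/-- Modulo boundaries and chains on faces with two vertices in a cell, a face is plus or minus
each of its swaps: all other terms of the boundary of the common coface have two vertices in
a cell. -/
theorem Swap.single_mem {p : ℕ} {σ σ' : Finset V} (h : Swap K κ p σ σ')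
    {X : Submodule k (Finset V →₀ k)} (hB : boundaries k K p ≤ X)
    (hX : Finsupp.supported k k (nonrainbow K κ p) ≤ X) (hσ : Finsupp.single σ 1 ∈ X) :
    Finsupp.single σ' 1 ∈ X := by
  obtain ⟨ρ, hρ, hc, a, ha, a', ha', hne, hκ, rfl, rfl⟩ := h
  have hsmul : ∀ (τ : Finset V) (s : k), Finsupp.single τ s = s • Finsupp.single τ 1 := by
    simp
  have h1 : boundary k (Finsupp.single ρ 1) ∈ X :=
    hB ⟨_, by rw [chains_succ]; exact Finsupp.single_mem_supported k _ ⟨hc, hρ⟩, rfl⟩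
  rw [boundary_single_one, ← Finset.add_sum_erase _ _ ha'] at h1
  have h2 : ∑ v ∈ ρ.erase a', Finsupp.single (ρ.erase v)
      ((-1 : k) ^ (ρ.filter (· < v)).card) ∈ X := by
    refine Submodule.sum_mem _ fun v hv => ?_
    obtain ⟨hva', hv⟩ := Finset.mem_erase.1 hv
    rw [hsmul]
    refine Submodule.smul_mem _ _ ?_
    by_cases hva : v = a
    · exact hva ▸ hσ
    · have hae : a ∈ ρ.erase v := Finset.mem_erase.2 ⟨fun h => hva h.symm, ha⟩
      have hae' : a' ∈ ρ.erase v := Finset.mem_erase.2 ⟨fun h => hva' h.symm, ha'⟩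
      refine hX (Finsupp.single_mem_supported k _ ⟨?_, ?_, fun hinj => ?_⟩)
      · rw [Finset.card_erase_of_mem hv, hc]; rfl
      · exact mem_of_subset hρ (Finset.erase_subset _ _) ⟨a, hae⟩
      · exact hne (hinj hae hae' hκ)
  have h3 := (Submodule.add_mem_iff_left X h2).1 h1
  rw [hsmul] at h3
  exact (Submodule.smul_mem_iff X (pow_ne_zero _ (by simp))).1 h3

theorem eqvGen_single_mem {p : ℕ} {σ σ' : Finset V} (h : Relation.EqvGen (Swap K κ p) σ σ')
    {X : Submodule k (Finset V →₀ k)} (hB : boundaries k K p ≤ X)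
    (hX : Finsupp.supported k k (nonrainbow K κ p) ≤ X) :
    Finsupp.single σ 1 ∈ X ↔ Finsupp.single σ' 1 ∈ X := by
  induction h with
  | rel _ _ h => exact ⟨h.single_mem hB hX, h.symm.single_mem hB hX⟩
  | refl _ => rfl
  | symm _ _ _ ih => exact ih.symm
  | trans _ _ _ _ _ ih ih' => exact ih.trans ih'

theorem chains_le_span {p : ℕ} {T : Finset (Finset V)}
    (hT : ∀ σ ∈ K, σ.card = p + 1 → Set.InjOn κ (σ : Set V) →
      ∃ t ∈ T, Relation.EqvGen (Swap K κ p) t σ) :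
    chains k K (p + 1) ≤
      Submodule.span k ((fun t => Finsupp.single t (1 : k)) '' (T : Set (Finset V))) ⊔
      (boundaries k K p ⊔ Finsupp.supported k k (nonrainbow K κ p)) := by
  intro z hz
  rw [chains_succ] at hz
  refine mem_of_supported (fun σ hσ => ?_) hz
  by_cases hinj : Set.InjOn κ (σ : Set V)
  · obtain ⟨t, ht, htσ⟩ := hT σ hσ.2 hσ.1 hinj
    refine (eqvGen_single_mem htσ (le_sup_left.trans le_sup_right)
      (le_sup_right.trans le_sup_right)).1 ?_
    exact Submodule.mem_sup_left (Submodule.subset_span ⟨t, ht, rfl⟩)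
  · exact Submodule.mem_sup_right (Submodule.mem_sup_right
      (Finsupp.single_mem_supported k _ ⟨hσ.1, hσ.2, hinj⟩))

theorem span_single_finite (T : Finset (Finset V)) :
    Module.Finite k
      (Submodule.span k ((fun t => Finsupp.single t (1 : k)) '' (T : Set (Finset V)))) ∧
    Module.finrank k
      (Submodule.span k ((fun t => Finsupp.single t (1 : k)) '' (T : Set (Finset V)))) ≤
        T.card := by
  classical
  rw [← Finset.coe_image]
  exact ⟨FiniteDimensional.span_finset k _,
    (finrank_span_finset_le_card _).trans Finset.card_image_le⟩

/-- Representatives of the classes of rainbow faces bound the dimension of the cycles modulo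
the boundaries and the cycles on the other faces. -/
theorem codimLE_nonrainbow {p : ℕ} {T : Finset (Finset V)}
    (hT : ∀ σ ∈ K, σ.card = p + 1 → Set.InjOn κ (σ : Set V) →
      ∃ t ∈ T, Relation.EqvGen (Swap K κ p) t σ) :
    CodimLE T.card (cycles k K p)
      (boundaries k K p ⊔ (cycles k K p ⊓ Finsupp.supported k k (nonrainbow K κ p))) := by
  have h : CodimLE T.card (cycles k K p)
      (boundaries k K p ⊔ Finsupp.supported k k (nonrainbow K κ p)) :=
    ⟨_, (span_single_finite T).1, (span_single_finite T).2, inf_le_left.trans (chains_le_span hT)⟩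
  refine h.inf.mono le_rfl le_rfl ?_
  rw [inf_comm, sup_inf_assoc_of_le _ (boundaries_le_cycles k K p), inf_comm]

end Flag

/-! ### Chains on simplices inside the cells -/

section Mono

theorem exists_apex {V ι : Type*} [Nonempty V] (κ : V → ι) (S : Finset V) :
    ∃ x : ι → V, ∀ v ∈ S, x (κ v) ∈ S ∧ κ (x (κ v)) = κ v := by
  classical
  refine ⟨fun i => if h : ∃ v ∈ S, κ v = i then h.choose else Classical.arbitrary V,
    fun v hv => ?_⟩
  have h : ∃ w ∈ S, κ w = κ v := ⟨v, hv, rfl⟩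
  simp only [dif_pos h]
  exact h.choose_spec

variable {k : Type*} [Field k] {V : Type*} [LinearOrder V] {ι : Type*}

/-- All vertices of the set `σ` lie in the same cell. -/
def Mono (κ : V → ι) (σ : Finset V) : Prop := ∀ u ∈ σ, ∀ v ∈ σ, κ u = κ v

open Classical in
/-- The operator that sends a nonempty set inside a cell `i` to its cone with apex `x i`, a vertex
chosen in that cell. (On other sets its values have no significance.) -/
noncomputable def cellCone (κ : V → ι) (x : ι → V) : (Finset V →₀ k) →ₗ[k] (Finset V →₀ k) :=
  Finsupp.linearCombination k fun σ : Finset V =>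
    if h : σ.Nonempty then cone (x (κ h.choose)) (Finsupp.single σ 1) else 0

variable {κ : V → ι} {x : ι → V}

theorem cellCone_single {σ : Finset V} (h : Mono κ σ) {v : V} (hv : v ∈ σ) :
    cellCone κ x (Finsupp.single σ 1) = cone (k := k) (x (κ v)) (Finsupp.single σ 1) := by
  have hne : σ.Nonempty := ⟨v, hv⟩
  rw [cellCone, Finsupp.linearCombination_single, one_smul, dif_pos hne,
    h _ hne.choose_spec v hv]

theorem boundary_cellCone {z : Finset V →₀ k}
    (hz : z ∈ Finsupp.supported k k {σ : Finset V | 2 ≤ σ.card ∧ Mono κ σ}) :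
    boundary k (cellCone κ x z) + cellCone κ x (boundary k z) = z := by
  refine eq_of_supported (boundary k ∘ₗ cellCone κ x + cellCone κ x ∘ₗ boundary k)
    LinearMap.id (fun σ hσ => ?_) hz
  obtain ⟨hc, hm⟩ := hσ
  obtain ⟨v, hv⟩ : σ.Nonempty := Finset.card_pos.1 (by omega)
  simp only [LinearMap.add_apply, LinearMap.comp_apply, LinearMap.id_apply]
  have h : cellCone κ x (boundary k (Finsupp.single σ 1)) =
      cone (x (κ v)) (boundary k (Finsupp.single σ (1 : k))) := by
    refine eq_of_supported (F := {τ | τ.Nonempty ∧ τ ⊆ σ}) _ _ (fun τ hτ => ?_)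
      (boundary_mem (Finsupp.single_mem_supported k _ (Set.mem_singleton σ)) ?_)
    · obtain ⟨⟨w, hw⟩, hτ⟩ := hτ
      rw [cellCone_single (fun u hu v hv => hm u (hτ hu) v (hτ hv)) hw, hm w (hτ hw) v hv]
    · rintro σ' rfl w hw
      refine ⟨Finset.card_pos.1 ?_, Finset.erase_subset _ _⟩
      rw [Finset.card_erase_of_mem hw]
      omega
  rw [h, cellCone_single hm hv, boundary_cone]

variable {r : V → V → Prop} {S : Finset V}

theorem cellCone_mem (hκ : ∀ u v, κ u = κ v → r u v)
    (hx : ∀ v ∈ S, x (κ v) ∈ S ∧ κ (x (κ v)) = κ v) {m : ℕ} {z : Finset V →₀ k}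
    (hz : z ∈ Finsupp.supported k k {σ : Finset V | σ.card = m + 1 ∧ σ ∈ flag r S ∧ Mono κ σ}) :
    cellCone κ x z ∈ Finsupp.supported k k
      {σ : Finset V | σ.card = m + 2 ∧ σ ∈ flag r S ∧ Mono κ σ} := by
  refine map_mem_of_supported _ (fun σ hσ => ?_) hz
  obtain ⟨hc, hf, hm⟩ := hσ
  obtain ⟨v, hv⟩ := hf.1
  rw [cellCone_single hm hv]
  refine cone_mem (Finsupp.single_mem_supported k _ (Set.mem_singleton σ)) ?_
  rintro σ' rfl hv'
  have hxv := hx v (hf.2.1 hv)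
  have hm' : Mono κ (insert (x (κ v)) σ') := by
    intro u hu w hw
    have : ∀ u ∈ insert (x (κ v)) σ', κ u = κ v := by
      intro u hu
      rcases Finset.mem_insert.1 hu with rfl | hu
      · exact hxv.2
      · exact hm u hu v hv
    rw [this u hu, this w hw]
  refine ⟨by rw [Finset.card_insert_of_notMem hv', hc], ⟨Finset.insert_nonempty _ _, ?_, ?_⟩, hm'⟩
  · exact Finset.insert_subset hxv.1 hf.2.1
  · exact fun u hu w hw => hκ u w (hm' u hu w hw)

/-- Cells are cliques, so cycles of positive dimension on simplices inside cells are
boundaries. -/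
theorem mem_boundaries_of_mono (hκ : ∀ u v, κ u = κ v → r u v)
    (hx : ∀ v ∈ S, x (κ v) ∈ S ∧ κ (x (κ v)) = κ v) {p : ℕ} {z : Finset V →₀ k}
    (hz : z ∈ Finsupp.supported k k
      {σ : Finset V | σ.card = p + 2 ∧ σ ∈ flag r S ∧ Mono κ σ})
    (h0 : boundary k z = 0) : z ∈ boundaries k (flag r S) (p + 1) := by
  refine ⟨cellCone κ x z, ?_, ?_⟩
  · rw [chains_succ]
    refine Finsupp.supported_mono ?_ (cellCone_mem hκ hx hz)
    rintro σ ⟨hc, hf, _⟩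
    exact ⟨hc, hf⟩
  · have hsub : {σ : Finset V | σ.card = p + 2 ∧ σ ∈ flag r S ∧ Mono κ σ} ⊆
        {σ : Finset V | 2 ≤ σ.card ∧ Mono κ σ} := by
      rintro σ ⟨hc, _, hm⟩
      exact ⟨by omega, hm⟩
    have := boundary_cellCone (x := x) (Finsupp.supported_mono hsub hz)
    rwa [h0, map_zero, add_zero] at this

end Mono

/-! ### Removing a vertex, and the first homology of two cliques -/

section Link

variable {k : Type*} [Field k] {V : Type*} [LinearOrder V] {r : V → V → Prop}

open Classical in
/-- Removing a vertex `a` lowers the dimension of the homology in degree `p + 1` at most by that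
of the homology of the link of `a` in degree `p`: if `y` is the boundary of the part of a
cycle `z` on the simplices that contain `a`, then `y` is a cycle of the link and that part is the
cone of `y`, so `z` is homologous to a cycle that avoids `a` when `y` bounds in the link. -/
theorem codimLE_insert (hr : ∀ u v, r u v → r v u) {S : Finset V} {a : V} (ha : a ∉ S)
    (haa : r a a) {p N : ℕ}
    (h : CodimLE N (cycles k (flag r (S.filter (r a))) p)
      (boundaries k (flag r (S.filter (r a))) p)) :
    CodimLE N (cycles k (flag r (insert a S)) (p + 1))
      (cycles k (flag r S) (p + 1) ⊔ boundaries k (flag r (insert a S)) (p + 1)) := by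
  -- the two descriptions of the supports of the parts of a chain
  have hpart : ∀ z ∈ cycles k (flag r (insert a S)) (p + 1),
      part (a ∈ ·) z ∈ Finsupp.supported k k
        {σ | σ.card = p + 2 ∧ σ ∈ flag r (insert a S) ∧ a ∈ σ} ∧
      z - part (a ∈ ·) z ∈ chains k (flag r S) (p + 2) := by
    rintro z ⟨hz, -⟩
    rw [chains_succ] at hz
    refine ⟨part_mem hz fun σ hσ haσ => ⟨hσ.1, hσ.2, haσ⟩, ?_⟩
    rw [chains_succ]
    refine sub_part_mem hz fun σ hσ haσ => ⟨hσ.1, hσ.2.1, fun v hv => ?_, hσ.2.2.2⟩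
    rcases Finset.mem_insert.1 (hσ.2.2.1 hv) with rfl | h
    · exact (haσ hv).elim
    · exact h
  have hcone : ∀ z ∈ cycles k (flag r (insert a S)) (p + 1),
      cone a (boundary k (part (a ∈ ·) z)) = part (a ∈ ·) z := by
    intro z hz
    have h0 : cone a (part (k := k) (a ∈ ·) z) = 0 :=
      eq_of_supported (cone a) 0 (fun σ hσ => by simp [cone_single_of_mem hσ.2.2])
        (hpart z hz).1
    have := boundary_cone (k := k) a (part (a ∈ ·) z)
    rwa [h0, map_zero, zero_add] at this
  refine (CodimLE.comap (boundary k ∘ₗ part (a ∈ ·)) (fun z hz => ?_) h).mono le_rfl le_rfl ?_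
  · refine ⟨?_, boundary_boundary k _⟩
    obtain ⟨h1, h2⟩ := hpart z hz
    have hneg : boundary k (part (a ∈ ·) z) = - boundary k (z - part (a ∈ ·) z) := by
      rw [map_sub, (LinearMap.mem_ker.1 hz.2 : boundary k z = 0), zero_sub, neg_neg]
    have h3 : boundary k (part (a ∈ ·) z) ∈
        Finsupp.supported k k {τ : Finset V | a ∉ τ} := by
      rw [hneg]
      refine Submodule.neg_mem _ ?_
      rw [chains_succ] at h2
      exact boundary_mem h2 fun σ hσ v hv haσ => ha (hσ.2.2.1 (Finset.mem_of_mem_erase haσ))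
    have h4 : boundary k (part (a ∈ ·) z) ∈ Finsupp.supported k k {τ : Finset V |
        ∃ σ, σ.card = p + 2 ∧ σ ∈ flag r (insert a S) ∧ a ∈ σ ∧ ∃ v ∈ σ, τ = σ.erase v} :=
      boundary_mem h1 fun σ hσ v hv => ⟨σ, hσ.1, hσ.2.1, hσ.2.2, v, hv, rfl⟩
    rw [LinearMap.comp_apply, chains_succ]
    have h5 := Submodule.mem_inf.2 ⟨h3, h4⟩
    rw [← Finsupp.supported_inter] at h5
    refine Finsupp.supported_mono ?_ h5
    rintro _ ⟨haτ, σ, hc, hσ, haσ, v, hv, rfl⟩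
    obtain rfl : a = v := by
      by_contra hne
      exact haτ (Finset.mem_erase.2 ⟨hne, haσ⟩)
    have hcard : (σ.erase a).card = p + 1 := by rw [Finset.card_erase_of_mem hv, hc]; rfl
    refine ⟨hcard, Finset.card_pos.1 (by omega), fun u hu => ?_, fun u hu w hw =>
      hσ.2.2 u (Finset.mem_of_mem_erase hu) w (Finset.mem_of_mem_erase hw)⟩
    obtain ⟨hua, hu⟩ := Finset.mem_erase.1 hu
    rcases Finset.mem_insert.1 (hσ.2.1 hu) with rfl | h
    · exact (hua rfl).elim
    · exact Finset.mem_filter.2 ⟨h, hσ.2.2 a haσ u hu⟩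
  · rintro z ⟨hz, w, hw, hwy⟩
    have h1 : part (a ∈ ·) z = w - boundary k (cone a w) := by
      rw [← hcone z hz, eq_sub_iff_add_eq, add_comm]
      have : boundary k w = boundary k (part (a ∈ ·) z) := hwy
      rw [← this, boundary_cone]
    have h2 : z + boundary k (cone a w) = (z - part (a ∈ ·) z) + w := by rw [h1]; abel
    have hcw : boundary k (cone a w) ∈ boundaries k (flag r (insert a S)) (p + 1) := by
      refine ⟨cone a w, ?_, rfl⟩
      rw [chains_succ] at hw ⊢
      exact cone_mem hw fun σ hσ haσ => ⟨by rw [Finset.card_insert_of_notMem haσ, hσ.1],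
        insert_mem_flag hr hσ.2 ((Finset.filter_subset _ _).trans (Finset.subset_insert _ _))
          (Finset.mem_insert_self a S) haa fun u hu => (Finset.mem_filter.1 (hσ.2.2.1 hu)).2⟩
    rw [← add_sub_cancel_right z (boundary k (cone a w))]
    refine Submodule.sub_mem _ (Submodule.mem_sup_left ⟨?_, ?_⟩) (Submodule.mem_sup_right hcw)
    · rw [h2]
      exact Submodule.add_mem _ (hpart z hz).2
        (chains_mono (fun σ hσ => flag_mono (Finset.filter_subset _ _) hσ) _ hw)
    · change boundary k _ = 0
      rw [map_add, boundary_boundary, add_zero]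
      exact hz.2

variable {ι : Type*} {κ : V → ι}

theorem mono_of_not_injOn {A B : ι} {σ : Finset V} (hσ : ∀ v ∈ σ, κ v = A ∨ κ v = B)
    (hc : σ.card = 2) (h : ¬ Set.InjOn κ (σ : Set V)) : Mono κ σ := by
  obtain ⟨u, v, huv, rfl⟩ := Finset.card_eq_two.1 hc
  have : κ u = κ v := by
    by_contra hne
    refine h fun x hx y hy hxy => ?_
    simp only [Finset.coe_insert, Finset.coe_singleton, Set.mem_insert_iff,
      Set.mem_singleton_iff] at hx hy
    rcases hx with rfl | rfl <;> rcases hy with rfl | rfl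
    · rfl
    · exact (hne hxy).elim
    · exact (hne hxy.symm).elim
    · rfl
  intro x hx y hy
  simp only [Finset.mem_insert, Finset.mem_singleton] at hx hy
  rcases hx with rfl | rfl <;> rcases hy with rfl | rfl <;> simp [this]

/-- The first homology of a flag complex whose vertices lie in two cells is spanned, up to
boundaries, by combinations of one edge from each class of edges between the cells. Only those
combinations count whose boundary has total coefficient `0` in the first cell, so the dimension is
smaller by one than the number of classes. -/
theorem codimLE_two_cells [Nonempty V] (hκ : ∀ u v, κ u = κ v → r u v) {S : Finset V} {A B : ι}
    (hAB : ∀ v ∈ S, κ v = A ∨ κ v = B) {T : Finset (Finset V)}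
    (hTS : ∀ t ∈ T, t.card = 2 ∧ Set.InjOn κ (t : Set V) ∧ ∀ v ∈ t, κ v = A ∨ κ v = B)
    (hT : ∀ σ ∈ flag r S, σ.card = 2 → Set.InjOn κ (σ : Set V) →
      ∃ t ∈ T, Relation.EqvGen (Swap (flag r S) κ 1) t σ) :
    CodimLE (T.card - 1) (cycles k (flag r S) 1) (boundaries k (flag r S) 1) := by
  classical
  obtain ⟨x, hx⟩ := exists_apex κ S
  let ε : (Finset V →₀ k) →ₗ[k] k := Finsupp.lapply ∅ ∘ₗ boundary k ∘ₗ
    part (fun τ => ∀ v ∈ τ, κ v = A) ∘ₗ boundary k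
  have hε : ∀ z, ε z = boundary k (part (fun τ => ∀ v ∈ τ, κ v = A) (boundary k z)) ∅ :=
    fun z => rfl
  have hε0 : ∀ z, boundary k z = 0 → ε z = 0 := fun z hz => by rw [hε, hz]; simp
  have hmono : Finsupp.supported k k (nonrainbow (flag r S) κ 1) ≤ Finsupp.supported k k
      {σ : Finset V | σ.card = 2 ∧ σ ∈ flag r S ∧ Mono κ σ} :=
    Finsupp.supported_mono fun σ hσ => ⟨hσ.1, hσ.2.1,
      mono_of_not_injOn (fun v hv => hAB v (hσ.2.1.2.1 hv)) hσ.1 hσ.2.2⟩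
  set W := boundaries k (flag r S) 1 ⊔
    Finsupp.supported k k {σ : Finset V | σ.card = 2 ∧ σ ∈ flag r S ∧ Mono κ σ} with hW
  have hWε : W ≤ LinearMap.ker ε := by
    refine sup_le ?_ fun z hz => ?_
    · rintro _ ⟨w, _, rfl⟩
      exact hε0 _ (boundary_boundary k w)
    · refine (map_mem_of_supported (X := ⊥) ε (fun σ hσ => ?_) hz : ε z ∈ (⊥ : Submodule k k))
      have hb : boundary k (Finsupp.single σ (1 : k)) ∈
          Finsupp.supported k k {τ : Finset V | τ.Nonempty ∧ τ ⊆ σ} :=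
        boundary_mem (Finsupp.single_mem_supported k _ (Set.mem_singleton σ)) (by
          rintro _ rfl v hv
          refine ⟨Finset.card_pos.1 ?_, Finset.erase_subset _ _⟩
          rw [Finset.card_erase_of_mem hv, hσ.1]; decide)
      obtain ⟨v, hv⟩ := hσ.2.1.1
      rw [Submodule.mem_bot, hε]
      by_cases hvA : κ v = A
      · rw [part_eq_self hb, boundary_boundary]
        · rfl
        · exact fun τ hτ u hu => (hσ.2.2 u (hτ.2 hu) v hv).trans hvA
      · rw [part_eq_zero hb, map_zero]
        · rfl
        · rintro τ ⟨⟨u, hu⟩, hτ⟩ hall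
          exact hvA ((hσ.2.2 v hv u (hτ hu)).trans (hall u hu))
  have hspan : cycles k (flag r S) 1 ≤
      (Submodule.span k ((fun t => Finsupp.single t (1 : k)) '' (T : Set (Finset V))) ⊓
        LinearMap.ker ε) ⊔ W := by
    intro z hz
    obtain ⟨t, ht, w, hw, htw⟩ := Submodule.mem_sup.1
      ((chains_le_span hT).trans (sup_le_sup_left (sup_le_sup_left hmono _) _) hz.1)
    have hεz : ε t + ε w = 0 := by rw [← map_add, htw]; exact hε0 z hz.2
    rw [(hWε hw : ε w = 0), add_zero] at hεz
    exact htw ▸ Submodule.add_mem_sup ⟨ht, hεz⟩ hw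
  have hcodim : CodimLE (T.card - 1) (cycles k (flag r S) 1) W := by
    have hfin := (span_single_finite (k := k) T).1
    refine ⟨_, Submodule.finiteDimensional_of_le inf_le_left, ?_, hspan⟩
    rcases T.eq_empty_or_nonempty with rfl | ⟨t, ht⟩
    · simp
    refine Nat.le_sub_one_of_lt (lt_of_lt_of_le (Submodule.finrank_lt_finrank_of_lt
      (inf_le_left.lt_of_not_ge fun hle => ?_)) (span_single_finite T).2)
    -- an edge between the cells has exactly one end in the first of them
    obtain ⟨hc, hinj, htAB⟩ := hTS t ht
    have hεt : ε (Finsupp.single t 1) = 0 :=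
      (hle (Submodule.subset_span ⟨t, ht, rfl⟩)).2
    obtain ⟨u, v, huv, huA, hvA, rfl⟩ : ∃ u v, u ≠ v ∧ κ u = A ∧ κ v ≠ A ∧ t = {u, v} := by
      obtain ⟨u, v, huv, rfl⟩ := Finset.card_eq_two.1 hc
      have hne : κ u ≠ κ v := fun h => huv (hinj (by simp) (by simp) h)
      rcases htAB u (by simp) with h1 | h1
      · exact ⟨u, v, huv, h1, fun h => hne (h1.trans h.symm), rfl⟩
      · rcases htAB v (by simp) with h2 | h2
        · exact ⟨v, u, huv.symm, h2, fun h => hne (h.trans h2.symm), Finset.pair_comm _ _⟩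
        · exact (hne (h1.trans h2.symm)).elim
    rw [hε, boundary_single_one, Finset.sum_pair huv, map_add, map_add,
      part_eq_zero (Finsupp.single_mem_supported k _ (Set.mem_singleton _)),
      part_eq_self (Finsupp.single_mem_supported k _ (Set.mem_singleton _)),
      map_zero, zero_add, boundary_single] at hεt
    · have h1 : ({u, v} : Finset V).erase v = {u} := by
        ext w; simp only [Finset.mem_erase, Finset.mem_insert, Finset.mem_singleton]; grind
      rw [h1] at hεt
      simp at hεt
    · rintro _ rfl w hw
      simp only [Finset.mem_erase, Finset.mem_insert, Finset.mem_singleton] at hw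
      rcases hw with ⟨h1, rfl | rfl⟩
      · exact huA
      · exact (h1 rfl).elim
    · rintro _ rfl hall
      exact hvA (hall v (Finset.mem_erase.2 ⟨huv.symm, by simp⟩))
  refine hcodim.inf.mono le_rfl le_rfl ?_
  rw [hW, inf_comm, sup_inf_assoc_of_le _ (boundaries_le_cycles k _ 1)]
  refine sup_le le_rfl ?_
  rintro z ⟨hz, hzc⟩
  exact mem_boundaries_of_mono hκ hx hz hzc.2

end Link

/-! ### Reduction to pairs of cells -/

section Pairs

theorem card_image_of_nonrainbow {V ι : Type*} [DecidableEq ι] {κ : V → ι}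
    {K : PreAbstractSimplicialComplex V} {σ : Finset V}
    (h : σ ∈ nonrainbow K κ 2) : (σ.image κ).card ≤ 2 := by
  obtain ⟨hc, _, hinj⟩ := h
  have h1 : (σ.image κ).card ≤ σ.card := Finset.card_image_le
  have h2 : (σ.image κ).card ≠ σ.card := fun h => hinj (Finset.card_image_iff.1 h)
  omega

theorem mono_of_card_image_le {V ι : Type*} [DecidableEq ι] {κ : V → ι} {σ : Finset V}
    (h : (σ.image κ).card ≤ 1) : Mono κ σ :=
  fun _ hu _ hv => Finset.card_le_one.1 h _ (Finset.mem_image_of_mem κ hu) _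
    (Finset.mem_image_of_mem κ hv)

variable {k : Type*} [Field k] {V : Type*} [LinearOrder V] {r : V → V → Prop}
  {ι : Type*} [DecidableEq ι] {κ : V → ι}

/-- A 2-cycle on triangles that meet at most two cells is, up to boundaries, a sum of cycles each
of which lives on two cells. The part of the cycle on the triangles that meet exactly two given
cells has its boundary inside these cells, and becomes a cycle when this boundary is filled
there. -/
theorem cycles_inf_nonrainbow_le [Nonempty V] (hκ : ∀ u v, κ u = κ v → r u v) (S : Finset V) :
    cycles k (flag r S) 2 ⊓ Finsupp.supported k k (nonrainbow (flag r S) κ 2) ≤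
      (⨆ π ∈ (S.image κ).powersetCard 2, cycles k (flag r (S.filter (κ · ∈ π))) 2) ⊔
        boundaries k (flag r S) 2 := by
  obtain ⟨x, hx⟩ := exists_apex κ S
  rintro z ⟨hz, hzn⟩
  have hz0 : boundary k z = 0 := hz.2
  set P := (S.image κ).powersetCard 2 with hP
  let q : Finset ι → (Finset V →₀ k) := fun π => part (fun σ => σ.image κ = π) z
  -- the boundary of the part of `z` over two cells lies inside these cells
  have hq : ∀ π ∈ P, boundary k (q π) ∈ Finsupp.supported k k
      {τ : Finset V | τ.card = 2 ∧ τ ∈ flag r (S.filter (κ · ∈ π)) ∧ Mono κ τ} := by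
    intro π hπ
    have hπ2 := (Finset.mem_powersetCard.1 hπ).2
    have h1 : boundary k (q π) ∈ Finsupp.supported k k
        {τ : Finset V | τ.card = 2 ∧ τ ∈ flag r (S.filter (κ · ∈ π))} := by
      refine boundary_mem (part_mem (G := {σ | σ.card = 3 ∧ σ ∈ flag r (S.filter (κ · ∈ π))})
        hzn ?_) ?_
      · rintro σ ⟨hc, hσ, _⟩ him
        refine ⟨hc, hσ.1, fun v hv => Finset.mem_filter.2 ⟨hσ.2.1 hv, ?_⟩, hσ.2.2⟩
        rw [← him]; exact Finset.mem_image_of_mem κ hv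
      · rintro σ ⟨hc, hσ⟩ v hv
        have hcard : (σ.erase v).card = 2 := by rw [Finset.card_erase_of_mem hv, hc]
        exact ⟨hcard, mem_of_subset hσ (Finset.erase_subset _ _)
          (Finset.card_pos.1 (by omega))⟩
    have h2 : boundary k (q π) ∈ Finsupp.supported k k {τ : Finset V | τ.image κ ≠ π} := by
      have hneg : boundary k (q π) = - boundary k (z - q π) := by
        rw [map_sub, hz0, zero_sub, neg_neg]
      rw [hneg]
      refine Submodule.neg_mem _ (boundary_mem (sub_part_mem
        (G := {σ | (σ.image κ).card ≤ 2 ∧ σ.image κ ≠ π}) hzn ?_) ?_)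
      · exact fun σ hσ him => ⟨card_image_of_nonrainbow hσ, him⟩
      · rintro σ ⟨hc, him⟩ v hv rfl
        exact him (Finset.eq_of_subset_of_card_le
          (Finset.image_subset_image (Finset.erase_subset v σ)) (by omega)).symm
    have h3 := Submodule.mem_inf.2 ⟨h1, h2⟩
    rw [← Finsupp.supported_inter] at h3
    refine Finsupp.supported_mono ?_ h3
    rintro τ ⟨⟨hc, hτ⟩, him⟩
    refine ⟨hc, hτ, mono_of_card_image_le ?_⟩
    have hsub : τ.image κ ⊆ π := by
      intro i hi
      obtain ⟨v, hv, rfl⟩ := Finset.mem_image.1 hi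
      exact (Finset.mem_filter.1 (hτ.2.1 hv)).2
    have := Finset.card_lt_card (hsub.ssubset_of_ne him)
    omega
  have hfill : ∀ π ∈ P, cellCone κ x (boundary k (q π)) ∈ Finsupp.supported k k
      {τ : Finset V | τ.card = 3 ∧ τ ∈ flag r (S.filter (κ · ∈ π)) ∧ Mono κ τ} := by
    intro π hπ
    refine cellCone_mem hκ (fun v hv => ?_) (hq π hπ)
    obtain ⟨hv, hvπ⟩ := Finset.mem_filter.1 hv
    refine ⟨Finset.mem_filter.2 ⟨(hx v hv).1, ?_⟩, (hx v hv).2⟩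
    rw [(hx v hv).2]; exact hvπ
  have hfill0 : ∀ π ∈ P, boundary k (cellCone κ x (boundary k (q π))) = boundary k (q π) := by
    intro π hπ
    have hsub : {τ : Finset V | τ.card = 2 ∧ τ ∈ flag r (S.filter (κ · ∈ π)) ∧ Mono κ τ} ⊆
        {τ : Finset V | 2 ≤ τ.card ∧ Mono κ τ} := by
      rintro τ ⟨hc, _, hm⟩
      exact ⟨hc.ge, hm⟩
    have := boundary_cellCone (x := x) (Finsupp.supported_mono hsub (hq π hπ))
    rwa [boundary_boundary, map_zero, add_zero] at this
  have hcyc : ∀ π ∈ P, q π - cellCone κ x (boundary k (q π)) ∈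
      cycles k (flag r (S.filter (κ · ∈ π))) 2 := by
    intro π hπ
    refine ⟨Submodule.sub_mem _ ?_ ?_, ?_⟩
    · rw [chains_succ]
      refine part_mem hzn ?_
      rintro σ ⟨hc, hσ, _⟩ him
      refine ⟨hc, hσ.1, fun v hv => Finset.mem_filter.2 ⟨hσ.2.1 hv, ?_⟩, hσ.2.2⟩
      rw [← him]; exact Finset.mem_image_of_mem κ hv
    · rw [chains_succ]
      refine Finsupp.supported_mono ?_ (hfill π hπ)
      rintro τ ⟨hc, hτ, _⟩
      exact ⟨hc, hτ⟩
    · change boundary k _ = 0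
      rw [map_sub, hfill0 π hπ, sub_self]
  -- what remains of `z` is a cycle on simplices inside the cells
  have hrest : z - ∑ π ∈ P, q π ∈ Finsupp.supported k k
      {σ : Finset V | σ.card = 3 ∧ σ ∈ flag r S ∧ Mono κ σ} := by
    have hzn' := (Finsupp.mem_supported' k z).1 hzn
    rw [Finsupp.mem_supported']
    intro σ hσ
    have h1 : (∑ π ∈ P, q π) σ = if σ.image κ ∈ P then z σ else 0 := by
      rw [Finsupp.finsetSum_apply, ← Finset.sum_ite_eq P (σ.image κ) (fun _ => z σ)]
      exact Finset.sum_congr rfl fun π _ => part_apply _ _ _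
    rw [Finsupp.sub_apply, h1]
    split_ifs with him
    · exact sub_self _
    · rw [sub_zero]
      refine hzn' σ fun hmem => ?_
      have hle := card_image_of_nonrainbow hmem
      rcases hle.lt_or_eq with hlt | heq
      · exact hσ ⟨hmem.1, hmem.2.1, mono_of_card_image_le (by omega)⟩
      · exact him (Finset.mem_powersetCard.2 ⟨Finset.image_subset_image hmem.2.1.2.1, heq⟩)
  have hfin : z - ∑ π ∈ P, (q π - cellCone κ x (boundary k (q π))) ∈
      boundaries k (flag r S) 2 := by
    refine mem_boundaries_of_mono hκ hx ?_ ?_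
    · rw [Finset.sum_sub_distrib, sub_sub_eq_add_sub, add_sub_right_comm]
      refine Submodule.add_mem _ hrest (Submodule.sum_mem _ fun π hπ =>
        Finsupp.supported_mono ?_ (hfill π hπ))
      rintro τ ⟨hc, hτ, hm⟩
      exact ⟨hc, flag_mono (Finset.filter_subset _ _) hτ, hm⟩
    · rw [map_sub, hz0, map_sum, Finset.sum_eq_zero, sub_zero]
      exact fun π hπ => (hcyc π hπ).2
  rw [← add_sub_cancel (∑ π ∈ P, (q π - cellCone κ x (boundary k (q π)))) z]
  refine Submodule.add_mem_sup (Submodule.sum_mem _ fun π hπ => ?_) hfin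
  exact (le_iSup₂ (f := fun π (_ : π ∈ P) =>
    cycles k (flag r (S.filter (κ · ∈ π))) 2) π hπ) (hcyc π hπ)

/-- The second Betti number of a flag complex is at most the number of classes of triangles that
meet three cells plus the sum of the second Betti numbers over the pairs of cells. -/
theorem codimLE_of_cells [Nonempty V] (hκ : ∀ u v, κ u = κ v → r u v) (S : Finset V)
    {T : Finset (Finset V)}
    (hT : ∀ σ ∈ flag r S, σ.card = 3 → Set.InjOn κ (σ : Set V) →
      ∃ t ∈ T, Relation.EqvGen (Swap (flag r S) κ 2) t σ)
    (N : Finset ι → ℕ)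
    (hN : ∀ π ∈ (S.image κ).powersetCard 2,
      CodimLE (N π) (cycles k (flag r (S.filter (κ · ∈ π))) 2)
        (boundaries k (flag r (S.filter (κ · ∈ π))) 2)) :
    CodimLE (T.card + ∑ π ∈ (S.image κ).powersetCard 2, N π)
      (cycles k (flag r S) 2) (boundaries k (flag r S) 2) := by
  refine (codimLE_nonrainbow hT).trans ?_
  have h := CodimLE.biSup ((S.image κ).powersetCard 2) N
    (fun π => cycles k (flag r (S.filter (κ · ∈ π))) 2) (boundaries k (flag r S) 2)
    fun π hπ => (hN π hπ).mono le_rfl le_rfl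
      (boundaries_mono (fun σ hσ => flag_mono (Finset.filter_subset _ _) hσ) 2)
  refine (h.sup (CodimLE.of_le le_rfl 0)).mono (by simp) (sup_le le_sup_right ?_) le_rfl
  exact cycles_inf_nonrainbow_le hκ S

end Pairs

/-! ### Counting gaps in a relation without crossings -/

section Gaps

variable {V L : Type*} [LinearOrder L] (r : V → V → Prop) (f : V → L) (A B : Finset V)

open Classical in
/-- The rows in `A` before the row `a`. Rows and columns are ordered by `f`. -/
noncomputable def before (a : V) : Finset V := A.filter (f · < f a)

open Classical in
/-- The columns related to the row `a` and to some row before it. -/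
noncomputable def oldCols (a : V) : Finset V :=
  B.filter fun c => r a c ∧ ∃ e ∈ before f A a, r e c

/-- Two old columns of the row `a` are joined if a row before `a` is related to both. -/
def Joined (a c d : V) : Prop :=
  c ∈ oldCols r f A B a ∧ d ∈ oldCols r f A B a ∧ ∃ e ∈ before f A a, r e c ∧ r e d

open Classical in
/-- The pairs of consecutive old columns of the row `a` that are not connected by joined pairs. -/
noncomputable def gaps (a : V) : Finset (V × V) :=
  (oldCols r f A B a ×ˢ oldCols r f A B a).filter fun x =>
    f x.1 < f x.2 ∧ (∀ d ∈ oldCols r f A B a, ¬ (f x.1 < f d ∧ f d < f x.2)) ∧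
      ¬ Relation.EqvGen (Joined r f A B a) x.1 x.2

variable {r f A B}

theorem mem_before {a e : V} : e ∈ before f A a ↔ e ∈ A ∧ f e < f a := by
  simp [before]

theorem mem_oldCols {a c : V} :
    c ∈ oldCols r f A B a ↔ c ∈ B ∧ r a c ∧ ∃ e ∈ before f A a, r e c := by
  simp [oldCols]

theorem mem_gaps {a c c' : V} : (c, c') ∈ gaps r f A B a ↔
    (c ∈ oldCols r f A B a ∧ c' ∈ oldCols r f A B a) ∧ f c < f c' ∧
      (∀ d ∈ oldCols r f A B a, ¬ (f c < f d ∧ f d < f c')) ∧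
      ¬ Relation.EqvGen (Joined r f A B a) c c' := by
  simp only [gaps, Finset.mem_filter, Finset.mem_product]

/-- The relation `r` between the rows `A` and the columns `B` has no crossings: if two related pairs
have their rows and their columns in opposite orders, then one of the two pairs that arise by
exchanging the columns is related, too. -/
def NoCrossing (r : V → V → Prop) (f : V → L) (A B : Finset V) : Prop :=
  ∀ a ∈ A, ∀ a' ∈ A, ∀ b ∈ B, ∀ b' ∈ B, f a < f a' → f b < f b' → r a b' → r a' b →
    r a b ∨ r a' b'

/-- An old column between two joined ones is connected to them. -/
theorem eqvGen_of_between (hf : Function.Injective f) (h : NoCrossing r f A B) {a x y z e : V}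
    (hx : x ∈ oldCols r f A B a) (hy : y ∈ oldCols r f A B a) (hz : z ∈ oldCols r f A B a)
    (hxy : f x < f y) (hyz : f y < f z) (he : e ∈ before f A a) (hex : r e x) (hez : r e z) :
    Relation.EqvGen (Joined r f A B a) x y := by
  obtain ⟨hyB, _, q, hq, hqy⟩ := mem_oldCols.1 hy
  have hxB := (mem_oldCols.1 hx).1
  have hzB := (mem_oldCols.1 hz).1
  have hqA := (mem_before.1 hq).1
  have heA := (mem_before.1 he).1
  rcases lt_trichotomy (f q) (f e) with hqe | hqe | hqe
  · rcases h q hqA e heA x hxB y hyB hqe hxy hqy hex with h1 | h1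
    · exact .rel _ _ ⟨hx, hy, q, hq, h1, hqy⟩
    · exact .rel _ _ ⟨hx, hy, e, he, hex, h1⟩
  · obtain rfl := hf hqe
    exact .rel _ _ ⟨hx, hy, q, hq, hex, hqy⟩
  · rcases h e heA q hqA y hyB z hzB hqe hyz hez hqy with h1 | h1
    · exact .rel _ _ ⟨hx, hy, e, he, hex, h1⟩
    · exact .trans _ _ _ (.rel _ _ ⟨hx, hz, e, he, hex, hez⟩)
        (.rel _ _ ⟨hz, hy, q, hq, h1, hqy⟩)

/-- A gap `(c, c')` occurs in one row only, as that row joins the two columns for later rows. -/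
theorem row_unique (hf : Function.Injective f) {a a' c c' : V} (ha : a ∈ A) (ha' : a' ∈ A)
    (h : (c, c') ∈ gaps r f A B a) (h' : (c, c') ∈ gaps r f A B a') : a = a' := by
  obtain ⟨⟨hc, hc'⟩, -, -, hn⟩ := mem_gaps.1 h
  obtain ⟨⟨hd, hd'⟩, -, -, hn'⟩ := mem_gaps.1 h'
  rcases lt_trichotomy (f a) (f a') with hlt | heq | hlt
  · exact (hn' (.rel _ _ ⟨hd, hd', a, mem_before.2 ⟨ha, hlt⟩, (mem_oldCols.1 hc).2.1,
      (mem_oldCols.1 hc').2.1⟩)).elim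
  · exact hf heq
  · exact (hn (.rel _ _ ⟨hc, hc', a', mem_before.2 ⟨ha', hlt⟩, (mem_oldCols.1 hd).2.1,
      (mem_oldCols.1 hd').2.1⟩)).elim

/-- Two gaps `(c, c')` and `(d, d')` without related columns in between do not cross. -/
theorem gaps_not_cross (h : NoCrossing r f A B) (hf : Function.Injective f)
    {i i' c c' d d' : V} (hi : i ∈ A) (hi' : i' ∈ A)
    (hc : (c, c') ∈ gaps r f A B i) (hc0 : ∀ b ∈ B, r i b → ¬ (f c < f b ∧ f b < f c'))
    (hd : (d, d') ∈ gaps r f A B i') (hd0 : ∀ b ∈ B, r i' b → ¬ (f d < f b ∧ f b < f d'))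
    (h1 : f c < f d) (h2 : f d < f c') (h3 : f c' < f d') : False := by
  obtain ⟨⟨hco, hco'⟩, -, -, hcn⟩ := mem_gaps.1 hc
  obtain ⟨⟨hdo, hdo'⟩, -, -, -⟩ := mem_gaps.1 hd
  obtain ⟨hcB, hic, -⟩ := mem_oldCols.1 hco
  obtain ⟨hcB', hic', -⟩ := mem_oldCols.1 hco'
  obtain ⟨hdB, hid, -⟩ := mem_oldCols.1 hdo
  obtain ⟨hdB', hid', -⟩ := mem_oldCols.1 hdo'
  rcases lt_trichotomy (f i) (f i') with hlt | heq | hlt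
  · rcases h i hi i' hi' d hdB c' hcB' hlt h2 hic' hid with h4 | h4
    · exact hc0 d hdB h4 ⟨h1, h2⟩
    · exact hd0 c' hcB' h4 ⟨h2, h3⟩
  · obtain rfl := hf heq
    exact hc0 d hdB hid ⟨h1, h2⟩
  · -- here the earlier row `i'` joins `c` and `d'`, two old columns of `i` on both sides of `c'`
    have h4 : r i d' := (h i' hi' i hi c' hcB' d' hdB' hlt h3 hid' hic').resolve_left
      fun h4 => hd0 c' hcB' h4 ⟨h2, h3⟩
    have h5 : r i' c := (h i' hi' i hi c hcB d hdB hlt h1 hid hic).resolve_right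
      fun h5 => hc0 d hdB h5 ⟨h1, h2⟩
    have hbef : i' ∈ before f A i := mem_before.2 ⟨hi', hlt⟩
    exact hcn (eqvGen_of_between hf h hco hco' (mem_oldCols.2 ⟨hdB', h4, i', hbef, hid'⟩)
      (h1.trans h2) h3 hbef h5 hid')

/-- The number of gaps is at most three times the number of columns. A gap with a column in between
that is related to its row is charged to that column, which is related to no earlier row. The
other gaps form a family of distinct intervals without crossings, so that each of them is the
longest one from its left end or the longest one from its right end. -/
theorem sum_card_gaps_le (h : NoCrossing r f A B) (hf : Function.Injective f) :
    ∑ a ∈ A, (gaps r f A B a).card ≤ 3 * B.card := by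
  classical
  rw [← Finset.card_sigma]
  set Γ := A.sigma (gaps r f A B) with hΓ
  let isNew : (Σ _ : V, V × V) → V → Prop := fun t d =>
    r t.1 d ∧ f t.2.1 < f d ∧ f d < f t.2.2
  let Γ₁ := Γ.filter fun t => ∃ d ∈ B, isNew t d
  let Γ₂ := Γ.filter fun t => ¬ ∃ d ∈ B, isNew t d
  let ΓL := Γ₂.filter fun t => ∀ t' ∈ Γ₂, t'.2.1 = t.2.1 → f t'.2.2 ≤ f t.2.2
  let ΓR := Γ₂.filter fun t => ∀ t' ∈ Γ₂, t'.2.2 = t.2.2 → f t.2.1 ≤ f t'.2.1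
  have hmem : ∀ {a c c'}, (⟨a, c, c'⟩ : Σ _ : V, V × V) ∈ Γ ↔
      a ∈ A ∧ (c, c') ∈ gaps r f A B a := fun {a c c'} => by rw [hΓ, Finset.mem_sigma]
  have hold : ∀ {a c c'}, (c, c') ∈ gaps r f A B a → c ∈ B ∧ c' ∈ B := fun hg =>
    ⟨(mem_oldCols.1 (mem_gaps.1 hg).1.1).1, (mem_oldCols.1 (mem_gaps.1 hg).1.2).1⟩
  have h1 : Γ₁.card ≤ B.card := by
    refine Finset.card_le_card_of_forall_subsingleton isNew
      (fun t ht => (Finset.mem_filter.1 ht).2) ?_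
    rintro d hd ⟨a, c, c'⟩ ⟨ht, had, hcd, hdc⟩ ⟨a', e, e'⟩ ⟨ht', had', hed, hde⟩
    obtain ⟨ha, hg⟩ := hmem.1 (Finset.mem_filter.1 ht).1
    obtain ⟨ha', hg'⟩ := hmem.1 (Finset.mem_filter.1 ht').1
    simp only at had hcd hdc had' hed hde
    have hnew : ∀ {a₁ a₂ x y : V}, a₁ ∈ A → r a₁ d → r a₂ d → (x, y) ∈ gaps r f A B a₂ →
        f x < f d → f d < f y → ¬ f a₁ < f a₂ := fun h₁ hr₁ hr₂ hg₂ hx hy hlt =>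
      (mem_gaps.1 hg₂).2.2.1 d (mem_oldCols.2 ⟨hd, hr₂, _, mem_before.2 ⟨h₁, hlt⟩, hr₁⟩) ⟨hx, hy⟩
    obtain rfl : a = a' := hf (le_antisymm (not_lt.1 (hnew ha' had' had hg hcd hdc))
      (not_lt.1 (hnew ha had had' hg' hed hde)))
    obtain ⟨⟨hc, hc'⟩, -, hb, -⟩ := mem_gaps.1 hg
    obtain ⟨⟨he, he'⟩, -, hb', -⟩ := mem_gaps.1 hg'
    have hce : c = e := hf (le_antisymm
      (not_lt.1 fun hlt => hb' c hc ⟨hlt, hcd.trans hde⟩)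
      (not_lt.1 fun hlt => hb e he ⟨hlt, hed.trans hdc⟩))
    have hce' : c' = e' := hf (le_antisymm
      (not_lt.1 fun hlt => hb e' he' ⟨hcd.trans hde, hlt⟩)
      (not_lt.1 fun hlt => hb' c' hc' ⟨hed.trans hdc, hlt⟩))
    rw [hce, hce']
  have hL : ΓL.card ≤ B.card := by
    refine Finset.card_le_card_of_injOn (fun t => t.2.1) ?_ ?_
    · rintro ⟨a, c, c'⟩ ht
      exact (hold (hmem.1 (Finset.mem_filter.1 (Finset.mem_filter.1 ht).1).1).2).1
    · rintro ⟨a, c, c'⟩ ht ⟨a', e, e'⟩ ht' (rfl : c = e)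
      obtain ⟨ht, hm⟩ := Finset.mem_filter.1 ht
      obtain ⟨ht', hm'⟩ := Finset.mem_filter.1 ht'
      obtain rfl : c' = e' := hf (le_antisymm (hm' _ ht rfl) (hm _ ht' rfl))
      obtain ⟨ha, hg⟩ := hmem.1 (Finset.mem_filter.1 ht).1
      obtain ⟨ha', hg'⟩ := hmem.1 (Finset.mem_filter.1 ht').1
      rw [row_unique hf ha ha' hg hg']
  have hR : ΓR.card ≤ B.card := by
    refine Finset.card_le_card_of_injOn (fun t => t.2.2) ?_ ?_
    · rintro ⟨a, c, c'⟩ ht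
      exact (hold (hmem.1 (Finset.mem_filter.1 (Finset.mem_filter.1 ht).1).1).2).2
    · rintro ⟨a, c, c'⟩ ht ⟨a', e, e'⟩ ht' (rfl : c' = e')
      obtain ⟨ht, hm⟩ := Finset.mem_filter.1 ht
      obtain ⟨ht', hm'⟩ := Finset.mem_filter.1 ht'
      obtain rfl : c = e := hf (le_antisymm (hm _ ht' rfl) (hm' _ ht rfl))
      obtain ⟨ha, hg⟩ := hmem.1 (Finset.mem_filter.1 ht).1
      obtain ⟨ha', hg'⟩ := hmem.1 (Finset.mem_filter.1 ht').1
      rw [row_unique hf ha ha' hg hg']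
  have h2 : Γ₂ ⊆ ΓL ∪ ΓR := by
    intro t ht
    by_contra hcon
    obtain ⟨hnL, hnR⟩ := not_or.1 fun hor => hcon (Finset.mem_union.2 hor)
    have hL' : ∃ t' ∈ Γ₂, t'.2.1 = t.2.1 ∧ f t.2.2 < f t'.2.2 := by
      by_contra! hall
      exact hnL (Finset.mem_filter.2 ⟨ht, hall⟩)
    have hR' : ∃ t' ∈ Γ₂, t'.2.2 = t.2.2 ∧ f t'.2.1 < f t.2.1 := by
      by_contra! hall
      exact hnR (Finset.mem_filter.2 ⟨ht, hall⟩)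
    obtain ⟨a, c, c'⟩ := t
    obtain ⟨⟨i, d, d'⟩, htl, (rfl : d = c), hlt⟩ := hL'
    obtain ⟨⟨j, e, e'⟩, htr, (rfl : e' = c'), hlt'⟩ := hR'
    have hgap : ∀ {a c c'}, (⟨a, c, c'⟩ : Σ _ : V, V × V) ∈ Γ₂ → a ∈ A ∧
        (c, c') ∈ gaps r f A B a ∧ ∀ b ∈ B, r a b → ¬ (f c < f b ∧ f b < f c') := by
      intro a c c' hmem₂
      obtain ⟨hm, hnew⟩ := Finset.mem_filter.1 hmem₂
      exact ⟨(hmem.1 hm).1, (hmem.1 hm).2, fun b hb hab hbet => hnew ⟨b, hb, hab, hbet⟩⟩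
    obtain ⟨hi, hgi, hi0⟩ := hgap htl
    obtain ⟨hj, hgj, hj0⟩ := hgap htr
    exact gaps_not_cross h hf hj hi hgj hj0 hgi hi0 hlt'
      (mem_gaps.1 (hgap ht).2.1).2.1 hlt
  have h3 : Γ₁.card + Γ₂.card = Γ.card := Finset.card_filter_add_card_filter_not _
  have h4 := (Finset.card_le_card h2).trans (Finset.card_union_le _ _)
  omega

/-- Every old column is connected to the first one or to the right end of a gap. -/
theorem exists_eqvGen_of_mem_oldCols [DecidableEq V] {a c₀ : V}
    (hc₀ : c₀ ∈ oldCols r f A B a) (hmin : ∀ c ∈ oldCols r f A B a, f c₀ ≤ f c)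
    (hf : Function.Injective f) {c : V} (hc : c ∈ oldCols r f A B a) :
    ∃ p ∈ insert c₀ ((gaps r f A B a).image Prod.snd),
      Relation.EqvGen (Joined r f A B a) p c := by
  classical
  by_contra hbad
  let bad := (oldCols r f A B a).filter fun c =>
    ¬ ∃ p ∈ insert c₀ ((gaps r f A B a).image Prod.snd), Relation.EqvGen (Joined r f A B a) p c
  obtain ⟨d, hd, hdmin⟩ := Finset.exists_min_image bad f ⟨c, Finset.mem_filter.2 ⟨hc, hbad⟩⟩
  obtain ⟨hd, hdbad⟩ := Finset.mem_filter.1 hd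
  have hlt : f c₀ < f d := by
    refine (hmin d hd).lt_of_ne fun heq => hdbad ⟨c₀, Finset.mem_insert_self _ _, ?_⟩
    rw [hf heq]; exact .refl _
  obtain ⟨e, he, hemax⟩ := Finset.exists_max_image ((oldCols r f A B a).filter (f · < f d)) f
    ⟨c₀, Finset.mem_filter.2 ⟨hc₀, hlt⟩⟩
  obtain ⟨he, hed⟩ := Finset.mem_filter.1 he
  by_cases hconn : Relation.EqvGen (Joined r f A B a) e d
  · have hebad : ¬ e ∈ bad := fun hmem => (hdmin e hmem).not_gt hed
    obtain ⟨p, hp, hpe⟩ : ∃ p ∈ insert c₀ ((gaps r f A B a).image Prod.snd),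
        Relation.EqvGen (Joined r f A B a) p e := by
      by_contra hcon
      exact hebad (Finset.mem_filter.2 ⟨he, hcon⟩)
    exact hdbad ⟨p, hp, hpe.trans _ _ _ hconn⟩
  · refine hdbad ⟨d, Finset.mem_insert_of_mem (Finset.mem_image.2 ⟨(e, d), mem_gaps.2
      ⟨⟨he, hd⟩, hed, fun b hb hbet => ?_, hconn⟩, rfl⟩), .refl _⟩
    exact (hemax b (Finset.mem_filter.2 ⟨hb, hbet.2⟩)).not_gt hbet.1

end Gaps

/-! ### Two cells -/

section TwoCells

variable {k : Type*} [Field k] {V : Type*} [LinearOrder V] {r : V → V → Prop}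
  {ι : Type*} {κ : V → ι} {L : Type*} [LinearOrder L] {f : V → L}

theorem swap_pair {S : Finset V} (hr : ∀ u v, r u v → r v u) (hκ : ∀ u v, κ u = κ v → r u v)
    {u u' c : V} (hu : u ∈ S) (hu' : u' ∈ S) (hc : c ∈ S) (huu : κ u = κ u') (huc : κ u ≠ κ c)
    (h : r u c) (h' : r u' c) :
    Relation.EqvGen (Swap (flag r S) κ 1) {u, c} {u', c} := by
  have hrefl : ∀ v, r v v := fun v => hκ v v rfl
  refine eqvGen_insert (Finset.card_singleton c) ?_ ?_ huu ?_
  · exact fun h => huc (congrArg κ (Finset.mem_singleton.1 h))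
  · exact fun h => huc (huu.trans (congrArg κ (Finset.mem_singleton.1 h)))
  · refine insert_mem_flag hr (insert_mem_flag hr (singleton_mem_flag hc (hrefl c)) subset_rfl hu'
      (hrefl _) ?_) subset_rfl hu (hrefl _) ?_
    · simpa using h'
    · simpa using ⟨hκ _ _ huu, h⟩

/-- When the rows of the first cell are added in their order, the first homology of the link of
a row `a` has dimension at most the number of gaps of `a`. -/
theorem codimLE_link [Nonempty V] (hr : ∀ u v, r u v → r v u) (hκ : ∀ u v, κ u = κ v → r u v)
    (hf : Function.Injective f) {A B : Finset V} {i j : ι} (hij : i ≠ j)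
    (hA : ∀ v ∈ A, κ v = i) (hB : ∀ v ∈ B, κ v = j) {a : V} (ha : a ∈ A) {S : Finset V}
    (hS : ∀ v, v ∈ S ↔ (v ∈ before f A a ∨ v ∈ B) ∧ r a v) :
    CodimLE (gaps r f A B a).card (cycles k (flag r S) 1) (boundaries k (flag r S) 1) := by
  have hSij : ∀ v ∈ S, κ v = i ∨ κ v = j := fun v hv =>
    ((hS v).1 hv).1.imp (fun h => hA v (mem_before.1 h).1) (hB v)
  have hrow : ∀ {e}, e ∈ before f A a → e ∈ S ∧ κ e = i := fun {e} he =>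
    have hei := hA e (mem_before.1 he).1
    ⟨(hS e).2 ⟨Or.inl he, hκ a e ((hA a ha).trans hei.symm)⟩, hei⟩
  have hcol : ∀ {c}, c ∈ oldCols r f A B a → c ∈ S ∧ κ c = j := fun {c} hc =>
    have h := mem_oldCols.1 hc
    ⟨(hS c).2 ⟨Or.inr h.1, h.2.1⟩, hB c h.1⟩
  -- an edge between the cells joins a row before `a` to an old column
  have hedge : ∀ σ ∈ flag r S, σ.card = 2 → Set.InjOn κ (σ : Set V) →
      ∃ u ∈ before f A a, ∃ c ∈ oldCols r f A B a, r u c ∧ σ = {u, c} := by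
    intro σ hσ hc hinj
    obtain ⟨u, v, huv, rfl⟩ := Finset.card_eq_two.1 hc
    have hne : κ u ≠ κ v := fun h => huv (hinj (by simp) (by simp) h)
    have key : ∀ u v, u ∈ S → v ∈ S → r u v → κ u = i → κ v = j →
        u ∈ before f A a ∧ v ∈ oldCols r f A B a := by
      intro u v hu hv huv hui hvj
      have hu1 : u ∈ before f A a := ((hS u).1 hu).1.resolve_right fun h =>
        hij (hui.symm.trans (hB u h))
      have hv1 : v ∈ B := ((hS v).1 hv).1.resolve_left fun h =>
        hij ((hrow h).2.symm.trans hvj)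
      exact ⟨hu1, mem_oldCols.2 ⟨hv1, ((hS v).1 hv).2, u, hu1, huv⟩⟩
    have hu : u ∈ S := hσ.2.1 (by simp)
    have hv : v ∈ S := hσ.2.1 (by simp)
    have huvr : r u v := hσ.2.2 u (by simp) v (by simp)
    rcases hSij u hu with h1 | h1 <;> rcases hSij v hv with h2 | h2
    · exact (hne (h1.trans h2.symm)).elim
    · exact ⟨u, (key u v hu hv huvr h1 h2).1, v, (key u v hu hv huvr h1 h2).2, huvr, rfl⟩
    · have h := key v u hv hu (hr _ _ huvr) h2 h1
      exact ⟨v, h.1, u, h.2, hr _ _ huvr, Finset.pair_comm _ _⟩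
    · exact (hne (h1.trans h2.symm)).elim
  rcases (oldCols r f A B a).eq_empty_or_nonempty with hemp | hne
  · have := codimLE_two_cells (k := k) hκ hSij (T := ∅) (by simp) fun σ hσ hc hinj => by
      obtain ⟨u, _, c, hc, _⟩ := hedge σ hσ hc hinj
      simp [hemp] at hc
    exact this.mono (by simp) le_rfl le_rfl
  obtain ⟨c₀, hc₀, hmin⟩ := Finset.exists_min_image _ f hne
  have hex : ∀ c, ∃ e, c ∈ oldCols r f A B a → e ∈ before f A a ∧ r e c := by
    intro c
    by_cases hc : c ∈ oldCols r f A B a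
    · obtain ⟨e, he, hec⟩ := (mem_oldCols.1 hc).2.2
      exact ⟨e, fun _ => ⟨he, hec⟩⟩
    · exact ⟨c, fun h => (hc h).elim⟩
  choose e he using hex
  set P := insert c₀ ((gaps r f A B a).image Prod.snd) with hP
  have hPold : ∀ p ∈ P, p ∈ oldCols r f A B a := by
    intro p hp
    rcases Finset.mem_insert.1 hp with rfl | hp
    · exact hc₀
    · obtain ⟨⟨c, c'⟩, hg, rfl⟩ := Finset.mem_image.1 hp
      exact (mem_gaps.1 hg).1.2
  have hrows : ∀ u u' c, u ∈ before f A a → u' ∈ before f A a → c ∈ oldCols r f A B a →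
      r u c → r u' c → Relation.EqvGen (Swap (flag r S) κ 1) {u, c} {u', c} := by
    intro u u' c hu hu' hc h h'
    have h1 := hrow hu
    have h2 := hrow hu'
    have h3 := hcol hc
    refine swap_pair hr hκ h1.1 h2.1 h3.1 (h1.2.trans h2.2.symm) ?_ h h'
    rw [h1.2, h3.2]; exact hij
  have hjoin : ∀ c d, Joined r f A B a c d →
      Relation.EqvGen (Swap (flag r S) κ 1) {e c, c} {e d, d} := by
    rintro c d ⟨hc, hd, u, hu, huc, hud⟩
    refine (hrows _ u c (he c hc).1 hu hc (he c hc).2 huc).trans _ _ _ (.trans _ {u, d} _ ?_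
      (hrows u _ d hu (he d hd).1 hd hud (he d hd).2))
    have h1 := hrow hu
    have h2 := hcol hc
    have h3 := hcol hd
    rw [Finset.pair_comm u c, Finset.pair_comm u d]
    refine swap_pair hr hκ h2.1 h3.1 h1.1 (h2.2.trans h3.2.symm) ?_ (hr _ _ huc) (hr _ _ hud)
    rw [h1.2, h2.2]; exact hij.symm
  have hconn : ∀ {c d}, Relation.EqvGen (Joined r f A B a) c d →
      Relation.EqvGen (Swap (flag r S) κ 1) {e c, c} {e d, d} := by
    intro c d h
    induction h with
    | rel _ _ h => exact hjoin _ _ h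
    | refl _ => exact .refl _
    | symm _ _ _ ih => exact .symm _ _ ih
    | trans _ _ _ _ _ ih ih' => exact .trans _ _ _ ih ih'
  have hT := codimLE_two_cells (k := k) hκ hSij (T := P.image fun p => {e p, p}) ?_ ?_
  · refine hT.mono ?_ le_rfl le_rfl
    have h1 : (P.image fun p => ({e p, p} : Finset V)).card ≤ P.card := Finset.card_image_le
    have h2 : P.card ≤ ((gaps r f A B a).image Prod.snd).card + 1 := Finset.card_insert_le _ _
    have h3 : ((gaps r f A B a).image Prod.snd).card ≤ (gaps r f A B a).card :=
      Finset.card_image_le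
    omega
  · intro t ht
    obtain ⟨p, hp, rfl⟩ := Finset.mem_image.1 ht
    have h1 := (hrow (he p (hPold p hp)).1).2
    have h2 := (hcol (hPold p hp)).2
    have hκne : κ (e p) ≠ κ p := by rw [h1, h2]; exact hij
    refine ⟨Finset.card_pair fun h => hκne (congrArg κ h), ?_, ?_⟩
    · rw [Finset.coe_pair, Set.injOn_pair]
      exact fun h => (hκne h).elim
    · intro v hv
      rcases Finset.mem_insert.1 hv with rfl | hv
      · exact Or.inl h1
      · rw [Finset.mem_singleton.1 hv]; exact Or.inr h2
  · intro σ hσ hc hinj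
    obtain ⟨u, hu, c, hco, huc, rfl⟩ := hedge σ hσ hc hinj
    obtain ⟨p, hp, hpc⟩ := exists_eqvGen_of_mem_oldCols hc₀ hmin hf hco
    exact ⟨_, Finset.mem_image_of_mem _ hp, (hconn hpc).trans _ _ _
      (hrows _ u c (he c hco).1 hu hco (he c hco).2 huc)⟩

/-- Two cells without crossings contribute at most three times the number of points of the second
cell to the second Betti number. -/
theorem codimLE_of_noCrossing [Nonempty V] [inst : DecidableEq V] (hr : ∀ u v, r u v → r v u)
    (hκ : ∀ u v, κ u = κ v → r u v) (hf : Function.Injective f) {A B : Finset V} {i j : ι}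
    (hij : i ≠ j) (hA : ∀ v ∈ A, κ v = i) (hB : ∀ v ∈ B, κ v = j) (h : NoCrossing r f A B) :
    CodimLE (3 * B.card) (cycles k (flag r (A ∪ B)) 2) (boundaries k (flag r (A ∪ B)) 2) := by
  obtain rfl : inst = fun a b => LinearOrder.toDecidableEq a b := Subsingleton.elim _ _
  classical
  suffices hs : ∀ s : Finset V, s ⊆ A → (∀ x ∈ s, ∀ y ∈ A, f y < f x → y ∈ s) →
      CodimLE (∑ a ∈ s, (gaps r f A B a).card) (cycles k (flag r (s ∪ B)) 2)
        (boundaries k (flag r (s ∪ B)) 2) from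
    (hs A subset_rfl fun _ _ y hy _ => hy).mono (sum_card_gaps_le h hf) le_rfl le_rfl
  intro s
  induction s using Finset.induction_on_max_value f with
  | empty =>
    intro _ _
    refine CodimLE.of_le (fun z hz => ?_) _
    rw [Finset.empty_union] at hz ⊢
    obtain ⟨x, hx⟩ := exists_apex κ B
    have hz1 := hz.1
    rw [chains_succ] at hz1
    refine mem_boundaries_of_mono hκ hx (Finsupp.supported_mono ?_ hz1) hz.2
    rintro σ ⟨hc, hσ⟩
    exact ⟨hc, hσ, fun u hu v hv => (hB u (hσ.2.1 hu)).trans (hB v (hσ.2.1 hv)).symm⟩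
  | insert a s has hmax ih =>
    intro hsub hlow
    have haA : a ∈ A := hsub (Finset.mem_insert_self a s)
    have hsA : s ⊆ A := (Finset.subset_insert a s).trans hsub
    have hbefore : s = before f A a := by
      ext y
      rw [mem_before]
      constructor
      · exact fun hy => ⟨hsA hy, (hmax y hy).lt_of_ne fun heq => has (hf heq ▸ hy)⟩
      · rintro ⟨hy, hlt⟩
        exact Finset.mem_of_mem_insert_of_ne (hlow a (Finset.mem_insert_self a s) y hy hlt)
          fun heq => hlt.ne (congrArg f heq)
    have haB : a ∉ B := fun haB => hij ((hA a haA).symm.trans (hB a haB))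
    have hlink := codimLE_link (k := k) hr hκ hf hij hA hB haA (S := (s ∪ B).filter (r a))
      fun v => by
      rw [Finset.mem_filter, Finset.mem_union, hbefore]
    have h1 := codimLE_insert hr (by simp [has, haB] : a ∉ s ∪ B) (hκ a a rfl) hlink
    have h2 := ih hsA fun x hx y hy hlt =>
      Finset.mem_of_mem_insert_of_ne (hlow x (Finset.mem_insert_of_mem hx) y hy hlt)
        fun heq => (heq ▸ hlt).not_ge (hmax x hx)
    rw [Finset.sum_insert has, Finset.insert_union]
    refine h1.trans ((h2.mono le_rfl le_rfl (boundaries_mono (fun σ hσ => flag_mono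
      (Finset.subset_insert _ _) hσ) 2)).sup (CodimLE.of_le le_rfl 0))

end TwoCells

/-! ### Plane geometry -/

section Geometry

local notation "ℝ²" => EuclideanSpace ℝ (Fin 2)

/-- If `a` is near `a₁` and `b` near `b₁`, and `ab` and `a₁b₁` have length at most `1` but `a₁b` and
`ab₁` do not, then `a₁ - a` is nearly orthogonal to `b - a`, and `a₁ - a` and `b₁ - b` form an acute
angle. -/
theorem inner_bounds_of_matching {E : Type*} [NormedAddCommGroup E] [InnerProductSpace ℝ E]
    {δ : ℝ} {a a₁ b b₁ : E} (hab : dist a b ≤ 1) (h₁ : dist a₁ b₁ ≤ 1) (h₂ : 1 < dist a₁ b)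
    (h₃ : 1 < dist a b₁) (ha : dist a₁ a ≤ δ) (hb : dist b₁ b ≤ δ) :
    |inner ℝ (a₁ - a) (b - a)| ≤ δ * ‖a₁ - a‖ ∧ 0 < inner ℝ (a₁ - a) (b₁ - b) := by
  set w := a₁ - a with hw
  set p := b - a with hp
  set t := b₁ - b with ht
  have e1 : dist a b = ‖p‖ := by rw [dist_comm, dist_eq_norm]
  have e2 : dist a₁ b = ‖w - p‖ := by rw [dist_eq_norm, hw, hp]; congr 1; abel
  have e3 : dist a b₁ = ‖p + t‖ := by rw [dist_comm, dist_eq_norm, hp, ht]; congr 1; abel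
  have e4 : dist a₁ b₁ = ‖w - (p + t)‖ := by rw [dist_eq_norm, hw, hp, ht]; congr 1; abel
  have e5 : dist a₁ a = ‖w‖ := dist_eq_norm _ _
  have e6 : dist b₁ b = ‖t‖ := dist_eq_norm _ _
  rw [e1] at hab; rw [e2] at h₂; rw [e3] at h₃; rw [e4] at h₁; rw [e5] at ha; rw [e6] at hb
  have f2 := norm_sub_sq_real w p
  have f4 := norm_sub_sq_real w (p + t)
  rw [inner_add_right] at f4
  have hcs := abs_le.1 (abs_real_inner_le_norm w t)
  have hw0 := norm_nonneg w
  have ht0 := norm_nonneg t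
  have g1 : ‖p‖ ^ 2 ≤ 1 := pow_le_one₀ (norm_nonneg p) hab
  have g2 : 1 < ‖w - p‖ ^ 2 := one_lt_pow₀ h₂ two_ne_zero
  have g3 : 1 < ‖p + t‖ ^ 2 := one_lt_pow₀ h₃ two_ne_zero
  have g4 : ‖w - (p + t)‖ ^ 2 ≤ 1 := pow_le_one₀ (norm_nonneg _) h₁
  have g5 : ‖w‖ * ‖t‖ ≤ δ * ‖w‖ := by nlinarith
  have g6 : ‖w‖ ^ 2 ≤ δ * ‖w‖ := by nlinarith
  have g7 := sq_nonneg ‖w‖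
  refine ⟨abs_le.2 ⟨?_, ?_⟩, ?_⟩ <;> linarith

/-- The Gram determinant of three vectors of the plane vanishes; multiplied by `‖p‖ ^ 2`, this takes
the following form. -/
theorem gram_plane (w p q : ℝ²) :
    (inner ℝ w q * ‖p‖ ^ 2 - inner ℝ w p * inner ℝ p q) ^ 2 =
      (‖p‖ ^ 2 * ‖w‖ ^ 2 - inner ℝ w p ^ 2) * (‖p‖ ^ 2 * ‖q‖ ^ 2 - inner ℝ p q ^ 2) := by
  simp only [EuclideanSpace.norm_sq_eq, PiLp.inner_apply, Fin.sum_univ_two, Real.norm_eq_abs,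
    sq_abs, RCLike.inner_apply, conj_trivial]
  ring

/-- The vector `w` is nearly orthogonal to the side `p` of a nearly equilateral triangle with
sides `p` and `q` at a vertex. If it does not point clearly along `q`, then it points clearly
against `q`. -/
theorem inner_le_of_nearly_orthogonal {w p q : ℝ²} (hw : 0 < ‖w‖)
    (hwp : |inner ℝ w p| ≤ 1 / 100 * ‖w‖) (hwq : inner ℝ w q ≤ 1 / 100 * ‖w‖)
    (hp : 98 / 100 ≤ ‖p‖) (hp1 : ‖p‖ ≤ 1) (hq : 98 / 100 ≤ ‖q‖) (hq1 : ‖q‖ ≤ 1)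
    (hpq : 98 / 100 ≤ ‖p - q‖) (hpq1 : ‖p - q‖ ≤ 1) :
    inner ℝ w q ≤ - (1 / 4 * ‖w‖) := by
  by_contra! hcon
  have hg := gram_plane w p q
  have hs := norm_sub_sq_real p q
  have hP : 96 / 100 ≤ ‖p‖ ^ 2 := by nlinarith
  have hP1 : ‖p‖ ^ 2 ≤ 1 := by nlinarith
  have hQ : 96 / 100 ≤ ‖q‖ ^ 2 := by nlinarith
  have hQ1 : ‖q‖ ^ 2 ≤ 1 := by nlinarith
  have hD : 96 / 100 ≤ ‖p - q‖ ^ 2 := by nlinarith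
  have hD1 : ‖p - q‖ ^ 2 ≤ 1 := by nlinarith
  set m := inner ℝ p q
  set x := inner ℝ w p
  set y := inner ℝ w q
  set n := ‖w‖
  obtain ⟨hx1, hx2⟩ := abs_le.1 hwp
  have hm : 46 / 100 ≤ m := by linarith
  have hm1 : m ≤ 52 / 100 := by linarith
  have h1 : 6 / 10 ≤ ‖p‖ ^ 2 * ‖q‖ ^ 2 - m ^ 2 := by
    have hPQ : (96 / 100 : ℝ) * (96 / 100) ≤ ‖p‖ ^ 2 * ‖q‖ ^ 2 :=
      mul_le_mul hP hQ (by norm_num) (sq_nonneg _)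
    have hm2 : m ^ 2 ≤ (52 / 100) ^ 2 := pow_le_pow_left₀ (by linarith) hm1 2
    linarith
  have h2 : 9 / 10 * n ^ 2 ≤ ‖p‖ ^ 2 * n ^ 2 - x ^ 2 := by
    have hPn : 96 / 100 * n ^ 2 ≤ ‖p‖ ^ 2 * n ^ 2 := mul_le_mul_of_nonneg_right hP (sq_nonneg n)
    have hx2 : x ^ 2 ≤ (1 / 100 * n) ^ 2 := by
      rw [← sq_abs]
      exact pow_le_pow_left₀ (abs_nonneg _) hwp 2
    rw [mul_pow] at hx2
    linarith [sq_nonneg n]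
  have h3 : 9 / 10 * n ^ 2 * (6 / 10) ≤
      (‖p‖ ^ 2 * n ^ 2 - x ^ 2) * (‖p‖ ^ 2 * ‖q‖ ^ 2 - m ^ 2) :=
    mul_le_mul h2 h1 (by norm_num) (le_trans (by positivity) h2)
  have h4 : |x * m| ≤ 1 / 100 * n := by
    rw [abs_mul, abs_of_pos (by linarith : (0 : ℝ) < m)]
    exact (mul_le_of_le_one_right (abs_nonneg x) (by linarith)).trans hwp
  have h5 : |y * ‖p‖ ^ 2| ≤ 1 / 4 * n := by
    have hy : |y| ≤ 1 / 4 * n := abs_le.2 ⟨hcon.le, by linarith⟩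
    rw [abs_mul, abs_of_nonneg (sq_nonneg ‖p‖)]
    exact (mul_le_of_le_one_right (abs_nonneg y) hP1).trans hy
  have h6 : |y * ‖p‖ ^ 2 - x * m| ≤ 3 / 10 * n := (abs_sub _ _).trans (by linarith)
  have h7 : (y * ‖p‖ ^ 2 - x * m) ^ 2 ≤ (3 / 10 * n) ^ 2 := by
    rw [← sq_abs]
    exact pow_le_pow_left₀ (abs_nonneg _) h6 2
  rw [mul_pow] at h7
  have h8 : 0 < n ^ 2 := pow_pos hw 2
  linarith

/-- A triangle `abc` cannot have both another triangle `a₁b₁c` with `a₁` farther from `c` and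
another triangle `a₂bc₂` with `a₂` farther from `b`, if none of the cross pairs is adjacent. If `r`
and `s` are the distances from `a` to `a₁` and to `a₂`, then the first triangle shows that `ac` is
shorter than `1` by at least a multiple of `r`, and the second that it is shorter by at most a small
multiple of `s`; and symmetrically for `ab`. -/
theorem not_both_farther {a b c a₁ b₁ a₂ c₂ : ℝ²}
    (hab : dist a b ≤ 1) (hac : dist a c ≤ 1) (hbc : dist b c ≤ 1) (hbc0 : 98 / 100 ≤ dist b c)
    (h11 : dist a₁ b₁ ≤ 1) (h1c : dist a₁ c ≤ 1) (h1b : 1 < dist a₁ b) (hab1 : 1 < dist a b₁)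
    (h22 : dist a₂ c₂ ≤ 1) (h2b : dist a₂ b ≤ 1) (h2c : 1 < dist a₂ c) (hac2 : 1 < dist a c₂)
    (hfar1 : dist a c ≤ dist a₁ c) (hfar2 : dist a b ≤ dist a₂ b)
    (ha1 : dist a₁ a ≤ 1 / 100) (hb1 : dist b₁ b ≤ 1 / 100) (ha2 : dist a₂ a ≤ 1 / 100)
    (hc2 : dist c₂ c ≤ 1 / 100) : False := by
  have key : ∀ {b c a₁ b₁ a₂ c₂ : ℝ²},
      dist a b ≤ 1 → dist a c ≤ 1 → dist b c ≤ 1 → 98 / 100 ≤ dist b c →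
      dist a₁ b₁ ≤ 1 → dist a₁ c ≤ 1 → 1 < dist a₁ b → 1 < dist a b₁ →
      dist a₂ c₂ ≤ 1 → 1 < dist a₂ c → 1 < dist a c₂ → dist a c ≤ dist a₁ c →
      dist a₁ a ≤ 1 / 100 → dist b₁ b ≤ 1 / 100 → dist a₂ a ≤ 1 / 100 → dist c₂ c ≤ 1 / 100 →
      dist a₁ a < 1 / 4 * dist a₂ a ∧ 0 < dist a₁ a := by
    clear * -
    intro b c a₁ b₁ a₂ c₂ hab hac hbc hbc0 h11 h1c h1b hab1 h22 h2c hac2 hfar1 ha1 hb1 ha2 hc2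
    have hperp1 := (inner_bounds_of_matching hab h11 h1b hab1 ha1 hb1).1
    have hperp2 := (inner_bounds_of_matching hac h22 h2c hac2 ha2 hc2).1
    have t1 := dist_triangle a₁ a b
    have t2 := dist_triangle a₂ a c
    set w := a₁ - a with hw
    set w₂ := a₂ - a with hw₂
    set p := b - a with hp
    set q := c - a with hq
    have e1 : dist a b = ‖p‖ := by rw [dist_comm, dist_eq_norm]
    have e2 : dist a c = ‖q‖ := by rw [dist_comm, dist_eq_norm]
    have e3 : dist b c = ‖p - q‖ := by rw [dist_eq_norm, hp, hq]; congr 1; abel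
    have e4 : dist a₁ c = ‖w - q‖ := by rw [dist_eq_norm, hw, hq]; congr 1; abel
    have e5 : dist a₂ c = ‖w₂ - q‖ := by rw [dist_eq_norm, hw₂, hq]; congr 1; abel
    have e6 : dist a₁ a = ‖w‖ := dist_eq_norm _ _
    have e7 : dist a₂ a = ‖w₂‖ := dist_eq_norm _ _
    rw [e1] at hab t1; rw [e2] at hac hfar1 t2; rw [e3] at hbc hbc0; rw [e4] at h1c hfar1
    rw [e5] at h2c t2; rw [e6] at ha1 t1 ⊢; rw [e7] at ha2 t2 ⊢
    have hw0 : 0 < ‖w‖ := by linarith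
    have f1 := norm_sub_sq_real w q
    have f2 := norm_sub_sq_real w₂ q
    have g1 : ‖q‖ ^ 2 ≤ ‖w - q‖ ^ 2 := pow_le_pow_left₀ (norm_nonneg q) hfar1 2
    have g2 : ‖w - q‖ ^ 2 ≤ 1 := pow_le_one₀ (norm_nonneg _) h1c
    have g3 : 1 < ‖w₂ - q‖ ^ 2 := one_lt_pow₀ h2c two_ne_zero
    have g4 : ‖w‖ ^ 2 ≤ 1 / 100 * ‖w‖ := by nlinarith
    have g5 : ‖w₂‖ ^ 2 ≤ 1 / 100 * ‖w₂‖ := by nlinarith [norm_nonneg w₂]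
    have hin := inner_le_of_nearly_orthogonal hw0 hperp1 (by linarith) (by linarith) hab
      (by linarith) hac hbc0 hbc
    have hin2 := (abs_le.1 hperp2).1
    refine ⟨?_, hw0⟩
    have := sq_nonneg ‖w‖
    linarith
  have k1 := key hab hac hbc hbc0 h11 h1c h1b hab1 h22 h2c hac2 hfar1 ha1 hb1 ha2 hc2
  have k2 := key hac hab (by rwa [dist_comm]) (by rwa [dist_comm]) h22 h2b h2c hac2 h11 h1b hab1
    hfar2 ha2 hc2 ha1 hb1
  linarith

/-- The height of a point in the direction orthogonal to `u`. -/
def height (u v : ℝ²) : ℝ := v 0 * u 1 - v 1 * u 0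

theorem norm_sq_mul_inner (u w t : ℝ²) :
    ‖u‖ ^ 2 * inner ℝ w t = inner ℝ w u * inner ℝ t u + height u w * height u t := by
  simp only [EuclideanSpace.norm_sq_eq, PiLp.inner_apply, Fin.sum_univ_two, Real.norm_eq_abs,
    sq_abs, RCLike.inner_apply, conj_trivial, height]
  ring

/-- If `ab'` and `a'b` have length at most `1` but `ab` and `a'b'` do not, then the order of `a`
and `a'` by height is opposite to that of `b` and `b'`: both `a' - a` and `b - b'` are nearly
orthogonal to `u`, and their scalar product is positive. -/
theorem height_lt_of_matching {u a a' b b' : ℝ²} (h1 : dist a b' ≤ 1) (h2 : dist a' b ≤ 1)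
    (h3 : 1 < dist a b) (h4 : 1 < dist a' b') (ha : dist a' a ≤ 1 / 100)
    (hb : dist b b' ≤ 1 / 100) (hu : ‖u - (b' - a)‖ ≤ 2 / 100) (hh : height u a ≤ height u a') :
    height u b' < height u b := by
  obtain ⟨hp1, hpos⟩ := inner_bounds_of_matching h1 h2 h4 h3 ha hb
  obtain ⟨hp2, -⟩ := inner_bounds_of_matching (a := b') (b := a) (a₁ := b) (b₁ := a')
    (by rwa [dist_comm]) (by rwa [dist_comm]) (by rwa [dist_comm]) (by rwa [dist_comm]) hb ha
  have t1 := dist_triangle a b' b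
  rw [dist_comm b' b] at t1
  have e1 : dist a b' = ‖b' - a‖ := by rw [dist_comm, dist_eq_norm]
  have t2 := norm_sub_norm_le (b' - a) u
  rw [norm_sub_rev (b' - a) u] at t2
  have hw : height u (a' - a) = height u a' - height u a := by
    simp only [height, PiLp.sub_apply]; ring
  have ht : height u (b - b') = height u b - height u b' := by
    simp only [height, PiLp.sub_apply]; ring
  have hu1 : 97 / 100 ≤ ‖u‖ := by linarith
  have hu2 : 9 / 10 ≤ ‖u‖ ^ 2 := by nlinarith
  set w := a' - a
  set t := b - b'
  have hflat : ∀ z : ℝ², |inner ℝ z (b' - a)| ≤ 1 / 100 * ‖z‖ →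
      |inner ℝ z u| ≤ 3 / 100 * ‖z‖ := by
    intro z hz
    have hs : inner ℝ z u = inner ℝ z (b' - a) + inner ℝ z (u - (b' - a)) := by
      rw [← inner_add_right]; congr 1; abel
    rw [hs]
    refine (abs_add_le _ _).trans ?_
    have := (abs_real_inner_le_norm z (u - (b' - a))).trans
      (mul_le_mul_of_nonneg_left hu (norm_nonneg z))
    linarith
  have hwu := hflat w hp1
  have htu := hflat t (by rw [← neg_sub a b', inner_neg_right, abs_neg]; exact hp2)
  have hhigh : ∀ z : ℝ², |inner ℝ z u| ≤ 3 / 100 * ‖z‖ → 9 / 10 * ‖z‖ ≤ |height u z| := by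
    intro z hz
    have h := norm_sq_mul_inner u z z
    rw [real_inner_self_eq_norm_sq] at h
    have h5 : inner ℝ z u * inner ℝ z u ≤ (3 / 100 * ‖z‖) ^ 2 := by
      rw [← sq, ← sq_abs]; exact pow_le_pow_left₀ (abs_nonneg _) hz 2
    refine abs_le_of_sq_le_sq' ?_ (abs_nonneg _) |>.2
    rw [sq_abs]
    nlinarith [sq_nonneg ‖z‖]
  have hw9 := hhigh w hwu
  have ht9 := hhigh t htu
  by_contra! hcon
  have hw0 : 0 ≤ height u w := by rw [hw]; linarith
  have ht0 : height u t ≤ 0 := by rw [ht]; linarith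
  rw [abs_of_nonneg hw0] at hw9
  rw [abs_of_nonpos ht0] at ht9
  have h5 := norm_sq_mul_inner u w t
  have h6 : inner ℝ w u * inner ℝ t u ≤ (3 / 100 * ‖w‖) * (3 / 100 * ‖t‖) := by
    refine (le_abs_self _).trans ?_
    rw [abs_mul]
    exact mul_le_mul hwu htu (abs_nonneg _) (by positivity)
  have h7 : (9 / 10 * ‖w‖) * (9 / 10 * ‖t‖) ≤ height u w * (- height u t) :=
    mul_le_mul hw9 ht9 (by positivity) hw0
  have h8 : 0 ≤ ‖w‖ * ‖t‖ := by positivity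
  have h9 : 0 < ‖u‖ ^ 2 * inner ℝ w t := mul_pos (by linarith) hpos
  linarith

end Geometry

/-! ### Grid cells in the plane -/

section Cells

local notation "ℝ²" => EuclideanSpace ℝ (Fin 2)

/-- Two points of the plane are adjacent if their distance is at most `1`. -/
def Adj (u v : ℝ²) : Prop := dist u v ≤ 1

theorem Adj.symm {u v : ℝ²} (h : Adj u v) : Adj v u := by
  unfold Adj at h ⊢
  rwa [dist_comm]

theorem ripsComplex_eq_flag (S : Finset ℝ²) : ripsComplex 1 S = flag Adj S := by
  refine SetLike.coe_injective (Set.ext fun σ => ?_)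
  change σ.Nonempty ∧ σ ⊆ S ∧ Metric.diam (σ : Set ℝ²) ≤ 1 ↔
    σ.Nonempty ∧ σ ⊆ S ∧ ∀ u ∈ σ, ∀ v ∈ σ, dist u v ≤ 1
  refine and_congr_right fun _ => and_congr_right fun _ => ⟨fun h u hu v hv => ?_, fun h => ?_⟩
  · exact (Metric.dist_le_diam_of_mem σ.finite_toSet.isBounded hu hv).trans h
  · exact Metric.diam_le_of_forall_dist_le zero_le_one fun u hu v hv => h u hu v hv

/-- The square of side `1 / 200` of the plane grid that contains the point `v`. -/
noncomputable def cell (v : ℝ²) : ℤ × ℤ := (⌊200 * v 0⌋, ⌊200 * v 1⌋)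

theorem dist_le_of_cell_eq {u v : ℝ²} (h : cell u = cell v) : dist u v ≤ 1 / 100 := by
  obtain ⟨h0, h1⟩ := Prod.ext_iff.1 h
  have h0 := abs_lt.1 (Int.abs_sub_lt_one_of_floor_eq_floor h0)
  have h1 := abs_lt.1 (Int.abs_sub_lt_one_of_floor_eq_floor h1)
  rw [EuclideanSpace.dist_eq, Fin.sum_univ_two, Real.dist_eq, Real.dist_eq, sq_abs, sq_abs]
  refine Real.sqrt_le_iff.2 ⟨by norm_num, ?_⟩
  have g0 : (u 0 - v 0) ^ 2 ≤ (1 / 200) ^ 2 := sq_le_sq' (by linarith) (by linarith)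
  have g1 : (u 1 - v 1) ^ 2 ≤ (1 / 200) ^ 2 := sq_le_sq' (by linarith) (by linarith)
  linarith

theorem adj_of_cell_eq (u v : ℝ²) (h : cell u = cell v) : Adj u v :=
  (dist_le_of_cell_eq h).trans (by norm_num)

/-- The offsets between cells that can contain points at distance at most `1`. The set is
irreducible, so that its size, which occurs as an exponent, is never evaluated. -/
@[irreducible]
noncomputable def offsets : Finset (ℤ × ℤ) := Finset.Icc (-201) 201 ×ˢ Finset.Icc (-201) 201

theorem mem_offsets {x : ℤ × ℤ} : x ∈ offsets ↔
    x.1 ∈ Finset.Icc (-201 : ℤ) 201 ∧ x.2 ∈ Finset.Icc (-201 : ℤ) 201 := by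
  unfold offsets
  exact Finset.mem_product

/-- The cells that can contain a point at distance at most `1` from a point of the cell `i`. -/
noncomputable def nearCells (i : ℤ × ℤ) : Finset (ℤ × ℤ) := offsets.image (i + ·)

theorem card_nearCells_le (i : ℤ × ℤ) : (nearCells i).card ≤ offsets.card :=
  Finset.card_image_le

theorem floor_sub_mem_Icc {x y : ℝ} (h : |x - y| ≤ 1) :
    ⌊200 * y⌋ - ⌊200 * x⌋ ∈ Finset.Icc (-201 : ℤ) 201 := by
  obtain ⟨h1, h2⟩ := abs_le.1 h
  have a1 := Int.floor_le (200 * x)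
  have a2 := Int.lt_floor_add_one (200 * x)
  have b1 := Int.floor_le (200 * y)
  have b2 := Int.lt_floor_add_one (200 * y)
  rw [Finset.mem_Icc]
  constructor
  · have : (-201 : ℝ) ≤ (⌊200 * y⌋ : ℝ) - ⌊200 * x⌋ := by linarith
    exact_mod_cast this
  · have : (⌊200 * y⌋ : ℝ) - ⌊200 * x⌋ ≤ 201 := by linarith
    exact_mod_cast this

theorem Adj.cell_mem {u v : ℝ²} (h : Adj u v) : cell v ∈ nearCells (cell u) := by
  have hcoord : ∀ i, |u i - v i| ≤ 1 := fun i => by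
    have := PiLp.norm_apply_le (u - v) i
    rw [PiLp.sub_apply, Real.norm_eq_abs] at this
    exact this.trans (by rw [← dist_eq_norm]; exact h)
  refine Finset.mem_image.2 ⟨cell v - cell u, mem_offsets.2
    ⟨floor_sub_mem_Icc (hcoord 0), floor_sub_mem_Icc (hcoord 1)⟩, add_sub_cancel _ _⟩

/-! ### Triangles on three cells -/

/-- A triangle on three given cells has one vertex in each of them. -/
theorem exists_triple {S σ : Finset ℝ²} {i j l : ℤ × ℤ} (hσ : σ ∈ flag Adj S) (hc : σ.card = 3)
    (hijl : ({i, j, l} : Finset (ℤ × ℤ)).card = 3) (him : σ.image cell = {i, j, l}) :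
    ∃ a ∈ S, ∃ b ∈ S, ∃ c ∈ S, cell a = i ∧ cell b = j ∧ cell c = l ∧ Adj a b ∧ Adj a c ∧
      Adj b c ∧ σ = {a, b, c} := by
  have hex : ∀ m ∈ ({i, j, l} : Finset (ℤ × ℤ)), ∃ v ∈ σ, cell v = m := fun m hm => by
    rw [← him] at hm
    exact Finset.mem_image.1 hm
  obtain ⟨a, ha, hai⟩ := hex i (by simp)
  obtain ⟨b, hb, hbj⟩ := hex j (by simp)
  obtain ⟨c, hcσ, hcl⟩ := hex l (by simp)
  refine ⟨a, hσ.2.1 ha, b, hσ.2.1 hb, c, hσ.2.1 hcσ, hai, hbj, hcl, hσ.2.2 a ha b hb,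
    hσ.2.2 a ha c hcσ, hσ.2.2 b hb c hcσ, (Finset.eq_of_subset_of_card_le ?_ ?_).symm⟩
  · simp [Finset.insert_subset_iff, ha, hb, hcσ]
  · have h : ({a, b, c} : Finset ℝ²).image cell = {i, j, l} := by
      simp [Finset.image_insert, hai, hbj, hcl]
    rw [hc, ← hijl, ← h]
    exact Finset.card_image_le

theorem eqvGen_triple {S : Finset ℝ²} {a a' b c : ℝ²} (ha : a ∈ S) (ha' : a' ∈ S) (hb : b ∈ S)
    (hc : c ∈ S) (haa : cell a = cell a') (hcab : cell a ≠ cell b) (hcac : cell a ≠ cell c)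
    (hcbc : cell b ≠ cell c) (hab : Adj a b) (hac : Adj a c) (hab' : Adj a' b) (hac' : Adj a' c)
    (hbc : Adj b c) : Relation.EqvGen (Swap (flag Adj S) cell 2) {a, b, c} {a', b, c} := by
  have hr : ∀ u v, Adj u v → Adj v u := fun _ _ h => h.symm
  have hrefl : ∀ v, Adj v v := fun v => adj_of_cell_eq v v rfl
  have hne : ∀ {u v : ℝ²}, cell u ≠ cell v → u ≠ v := fun h h' => h (congrArg cell h')
  refine eqvGen_insert (Finset.card_pair (hne hcbc)) ?_ ?_ haa ?_
  · simp [hne hcab, hne hcac]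
  · rw [haa] at hcab hcac
    simp [hne hcab, hne hcac]
  · refine insert_mem_flag hr (insert_mem_flag hr (insert_mem_flag hr
      (singleton_mem_flag hc (hrefl c)) subset_rfl hb (hrefl b) ?_) subset_rfl ha' (hrefl a') ?_)
      subset_rfl ha (hrefl a) ?_
    · simpa using hbc
    · simpa using ⟨hab', hac'⟩
    · simpa using ⟨adj_of_cell_eq _ _ haa, hab, hac⟩

/-- Pairwise inequivalent triangles on three given cells are at most as many as the points in these
cells. If the last two cells are completely joined, a triangle is charged to its vertex in the
first cell. Otherwise it is charged to a vertex `v` in one of the last two cells such that all other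
triangles with vertex `v` have their vertex in the first cell nearer to `v`; by `not_both_farther`
one of its two vertices there is as required. -/
theorem card_le_of_inequivalent {S : Finset ℝ²} {π : Finset (ℤ × ℤ)} (hπ : π.card = 3)
    {T : Finset (Finset ℝ²)}
    (hT : ∀ t ∈ T, t ∈ flag Adj S ∧ t.card = 3 ∧ t.image cell = π)
    (hind : ∀ t ∈ T, ∀ t' ∈ T, Relation.EqvGen (Swap (flag Adj S) cell 2) t t' → t = t') :
    T.card ≤ (S.filter (cell · ∈ π)).card := by
  obtain ⟨i, j, l, hij, hil, hjl, rfl⟩ := Finset.card_eq_three.1 hπ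
  -- the vertices of a triangle, and their uniqueness in the cells
  have hvert : ∀ t ∈ T, ∃ a ∈ S, ∃ b ∈ S, ∃ c ∈ S, cell a = i ∧ cell b = j ∧ cell c = l ∧
      Adj a b ∧ Adj a c ∧ Adj b c ∧ t = {a, b, c} := fun t ht =>
    exists_triple (hT t ht).1 (hT t ht).2.1 hπ (hT t ht).2.2
  have hmem : ∀ {a b c v : ℝ²}, v ∈ ({a, b, c} : Finset ℝ²) → v = a ∨ v = b ∨ v = c := by
    intro a b c v h
    simpa using h
  have hi : ∀ {a b c v : ℝ²}, cell b = j → cell c = l → v ∈ ({a, b, c} : Finset ℝ²) →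
      cell v = i → v = a := by
    intro a b c v hb hc hv hvi
    rcases hmem hv with rfl | rfl | rfl
    · rfl
    · exact (hij (hvi.symm.trans hb)).elim
    · exact (hil (hvi.symm.trans hc)).elim
  have hj : ∀ {a b c v : ℝ²}, cell a = i → cell c = l → v ∈ ({a, b, c} : Finset ℝ²) →
      cell v = j → v = b := by
    intro a b c v ha hc hv hvj
    rcases hmem hv with rfl | rfl | rfl
    · exact (hij (ha.symm.trans hvj)).elim
    · rfl
    · exact (hjl (hvj.symm.trans hc)).elim
  have hl : ∀ {a b c v : ℝ²}, cell a = i → cell b = j → v ∈ ({a, b, c} : Finset ℝ²) →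
      cell v = l → v = c := by
    intro a b c v ha hb hv hvl
    rcases hmem hv with rfl | rfl | rfl
    · exact (hil (ha.symm.trans hvl)).elim
    · exact (hjl (hb.symm.trans hvl)).elim
    · rfl
  -- moving one vertex inside its cell does not change the class of a triangle
  have hmoveA : ∀ {a a' b c : ℝ²}, a ∈ S → a' ∈ S → b ∈ S → c ∈ S → cell a = i → cell a' = i →
      cell b = j → cell c = l → Adj a b → Adj a c → Adj a' b → Adj a' c → Adj b c →
      Relation.EqvGen (Swap (flag Adj S) cell 2) {a, b, c} {a', b, c} := by
    intro a a' b c ha ha' hb hc hai hai' hbj hcl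
    exact eqvGen_triple ha ha' hb hc (hai.trans hai'.symm) (by rwa [hai, hbj])
      (by rwa [hai, hcl]) (by rwa [hbj, hcl])
  have hmoveB : ∀ {a b b' c : ℝ²}, a ∈ S → b ∈ S → b' ∈ S → c ∈ S → cell a = i → cell b = j →
      cell b' = j → cell c = l → Adj a b → Adj b c → Adj a b' → Adj b' c → Adj a c →
      Relation.EqvGen (Swap (flag Adj S) cell 2) {a, b, c} {a, b', c} := by
    intro a b b' c ha hb hb' hc hai hbj hbj' hcl hab hbc hab' hbc' hac
    rw [Finset.insert_comm a b, Finset.insert_comm a b']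
    exact eqvGen_triple hb hb' ha hc (hbj.trans hbj'.symm) (by rw [hbj, hai]; exact hij.symm)
      (by rwa [hbj, hcl]) (by rwa [hai, hcl]) hab.symm hbc hab'.symm hbc' hac
  have hmoveC : ∀ {a b c c' : ℝ²}, a ∈ S → b ∈ S → c ∈ S → c' ∈ S → cell a = i → cell b = j →
      cell c = l → cell c' = l → Adj a c → Adj b c → Adj a c' → Adj b c' → Adj a b →
      Relation.EqvGen (Swap (flag Adj S) cell 2) {a, b, c} {a, b, c'} := by
    intro a b c c' ha hb hc hc' hai hbj hcl hcl' hac hbc hac' hbc' hab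
    have hrot : ∀ x : ℝ², ({a, b, x} : Finset ℝ²) = {x, a, b} := fun x => by
      rw [Finset.pair_comm b x, Finset.insert_comm a x]
    rw [hrot, hrot]
    exact eqvGen_triple hc hc' ha hb (hcl.trans hcl'.symm) (by rw [hcl, hai]; exact hil.symm)
      (by rw [hcl, hbj]; exact hjl.symm) (by rwa [hai, hbj]) hac.symm hbc.symm hac'.symm
      hbc'.symm hab
  by_cases hcomplete : ∀ b ∈ S, ∀ c ∈ S, cell b = j → cell c = l → Adj b c
  · refine Finset.card_le_card_of_forall_subsingleton (fun t v => v ∈ t ∧ cell v = i)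
      (fun t ht => ?_) ?_
    · obtain ⟨a, ha, b, _, c, _, hai, _, _, _, _, _, rfl⟩ := hvert t ht
      exact ⟨a, Finset.mem_filter.2 ⟨ha, by simp [hai]⟩, by simp, hai⟩
    · rintro v hv t ⟨ht, hvt, hvi⟩ t' ⟨ht', hvt', -⟩
      obtain ⟨a, ha, b, hb, c, hc, hai, hbj, hcl, hab, hac, hbc, rfl⟩ := hvert t ht
      obtain ⟨a', ha', b', hb', c', hc', hai', hbj', hcl', hab', hac', hbc', rfl⟩ := hvert t' ht'
      obtain rfl := hi hbj hcl hvt hvi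
      obtain rfl := hi hbj' hcl' hvt' hvi
      have hcross := hcomplete b' hb' c hc hbj' hcl
      exact hind _ ht _ ht' ((hmoveB ha hb hb' hc hai hbj hbj' hcl hab hbc hab' hcross hac).trans
        _ _ _ (hmoveC ha hb' hc hc' hai hbj' hcl hcl' hac hcross hac' hbc' hab'))
  · -- a pair of points at distance more than `1` shows that these two cells are far apart
    push Not at hcomplete
    obtain ⟨b₀, hb₀, c₀, hc₀, hbj₀, hcl₀, hfar⟩ := hcomplete
    have hfar' : ∀ {b c : ℝ²}, cell b = j → cell c = l → 98 / 100 ≤ dist b c := by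
      intro b c hb hc
      have h1 := dist_le_of_cell_eq (hbj₀.trans hb.symm)
      have h2 := dist_le_of_cell_eq (hc.trans hcl₀.symm)
      have h3 : 1 < dist b₀ c₀ := not_le.1 hfar
      have h4 := dist_triangle4 b₀ b c c₀
      linarith
    refine Finset.card_le_card_of_forall_subsingleton (fun t v => v ∈ t ∧ ∃ a ∈ t, cell a = i ∧
      ∀ t' ∈ T, t' ≠ t → v ∈ t' → ∀ a' ∈ t', cell a' = i → dist a' v < dist a v)
      (fun t ht => ?_) ?_
    · obtain ⟨a, ha, b, hb, c, hc, hai, hbj, hcl, hab, hac, hbc, rfl⟩ := hvert t ht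
      by_contra hno
      have hnoc : ∃ t' ∈ T, t' ≠ {a, b, c} ∧ c ∈ t' ∧ ∃ a' ∈ t', cell a' = i ∧
          dist a c ≤ dist a' c := by
        by_contra! hcon
        exact hno ⟨c, Finset.mem_filter.2 ⟨hc, by simp [hcl]⟩, by simp, a, by simp, hai, hcon⟩
      have hnob : ∃ t' ∈ T, t' ≠ {a, b, c} ∧ b ∈ t' ∧ ∃ a' ∈ t', cell a' = i ∧
          dist a b ≤ dist a' b := by
        by_contra! hcon
        exact hno ⟨b, Finset.mem_filter.2 ⟨hb, by simp [hbj]⟩, by simp, a, by simp, hai, hcon⟩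
      obtain ⟨t₁, ht₁, hne₁, hct₁, a', ha't, ha'i, hd₁⟩ := hnoc
      obtain ⟨a₁, ha₁, b₁, hb₁, c₁, hc₁, hai₁, hbj₁, hcl₁, hab₁, hac₁, hbc₁, rfl⟩ := hvert t₁ ht₁
      obtain rfl := hl hai₁ hbj₁ hct₁ hcl
      obtain rfl := hi hbj₁ hcl₁ ha't ha'i
      obtain ⟨t₂, ht₂, hne₂, hbt₂, a'', ha''t, ha''i, hd₂⟩ := hnob
      obtain ⟨a₂, ha₂, b₂, hb₂, c₂, hc₂, hai₂, hbj₂, hcl₂, hab₂, hac₂, hbc₂, rfl⟩ := hvert t₂ ht₂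
      obtain rfl := hj hai₂ hcl₂ hbt₂ hbj
      obtain rfl := hi hbj₂ hcl₂ ha''t ha''i
      have h1b : ¬ Adj a' b := fun h => hne₁ (hind _ ht _ ht₁
        ((hmoveA ha ha₁ hb hc hai hai₁ hbj hcl hab hac h hac₁ hbc).trans _ _ _
        (hmoveB ha₁ hb hb₁ hc hai₁ hbj hbj₁ hcl h hbc hab₁ hbc₁ hac₁))).symm
      have hab1 : ¬ Adj a b₁ := fun h => hne₁ (hind _ ht _ ht₁
        ((hmoveB ha hb hb₁ hc hai hbj hbj₁ hcl hab hbc h hbc₁ hac).trans _ _ _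
        (hmoveA ha ha₁ hb₁ hc hai hai₁ hbj₁ hcl h hac hab₁ hac₁ hbc₁))).symm
      have h2c : ¬ Adj a'' c := fun h => hne₂ (hind _ ht _ ht₂
        ((hmoveA ha ha₂ hb hc hai hai₂ hbj hcl hab hac hab₂ h hbc).trans _ _ _
        (hmoveC ha₂ hb hc hc₂ hai₂ hbj hcl hcl₂ h hbc hac₂ hbc₂ hab₂))).symm
      have hac2 : ¬ Adj a c₂ := fun h => hne₂ (hind _ ht _ ht₂
        ((hmoveC ha hb hc hc₂ hai hbj hcl hcl₂ hac hbc h hbc₂ hab).trans _ _ _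
        (hmoveA ha ha₂ hb hc₂ hai hai₂ hbj hcl₂ hab h hab₂ hac₂ hbc₂))).symm
      exact not_both_farther hab hac hbc (hfar' hbj hcl) hab₁ hac₁ (not_le.1 h1b) (not_le.1 hab1)
        hac₂ hab₂ (not_le.1 h2c) (not_le.1 hac2) hd₁ hd₂
        (dist_le_of_cell_eq (hai₁.trans hai.symm)) (dist_le_of_cell_eq (hbj₁.trans hbj.symm))
        (dist_le_of_cell_eq (hai₂.trans hai.symm)) (dist_le_of_cell_eq (hcl₂.trans hcl.symm))
    · rintro v hv t ⟨ht, hvt, a, hat, hai, hmax⟩ t' ⟨ht', hvt', a', hat', hai', hmax'⟩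
      by_contra hne
      exact lt_asymm (hmax t' ht' (Ne.symm hne) hvt' a' hat' hai')
        (hmax' t ht hne hvt a hat hai)

/-! ### The linear bound -/

/-- In the order by height orthogonally to the direction between two cells, the adjacency relation
between the cells has no crossings. -/
theorem exists_noCrossing {A B : Finset ℝ²} {i j : ℤ × ℤ} (hA : ∀ v ∈ A, cell v = i)
    (hB : ∀ v ∈ B, cell v = j) :
    ∃ f : ℝ² → ℝ ×ₗ ℝ², Function.Injective f ∧ NoCrossing Adj f A B := by
  have key : ∀ u : ℝ², (∀ a ∈ A, ∀ b ∈ B, ‖u - (b - a)‖ ≤ 2 / 100) →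
      ∃ f : ℝ² → ℝ ×ₗ ℝ², Function.Injective f ∧ NoCrossing Adj f A B := by
    intro u hu
    refine ⟨fun v => toLex (height u v, v), fun v w h => ?_, ?_⟩
    · exact (Prod.ext_iff.1 (toLex.injective h)).2
    · intro a ha a' ha' b hb b' hb' haa hbb h1 h2
      have hle : ∀ {v w : ℝ²}, toLex (height u v, v) < toLex (height u w, w) →
          height u v ≤ height u w := fun h => by
        rcases Prod.Lex.toLex_lt_toLex.1 h with h | h
        · exact h.le
        · exact h.1.le
      by_contra! hcon
      exact (hle hbb).not_gt (height_lt_of_matching h1 h2 (not_le.1 hcon.1) (not_le.1 hcon.2)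
        (dist_le_of_cell_eq ((hA a' ha').trans (hA a ha).symm))
        (dist_le_of_cell_eq ((hB b hb).trans (hB b' hb').symm)) (hu a ha b' hb') (hle haa))
  rcases A.eq_empty_or_nonempty with rfl | ⟨a₀, ha₀⟩
  · exact key 0 (by simp)
  rcases B.eq_empty_or_nonempty with rfl | ⟨b₀, hb₀⟩
  · exact key 0 (by simp)
  refine key (b₀ - a₀) fun a ha b hb => ?_
  have h1 := dist_le_of_cell_eq ((hA a ha).trans (hA a₀ ha₀).symm)
  have h2 := dist_le_of_cell_eq ((hB b₀ hb₀).trans (hB b hb).symm)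
  rw [dist_eq_norm] at h1 h2
  have h3 : b₀ - a₀ - (b - a) = (b₀ - b) + (a - a₀) := by abel
  rw [h3]
  exact (norm_add_le _ _).trans (by linarith)

variable (k : Type*) [Field k]

theorem codimLE_pair_of_cells (S : Finset ℝ²) {π : Finset (ℤ × ℤ)} (hπ : π.card = 2) :
    CodimLE (3 * (S.filter (cell · ∈ π)).card)
      (cycles k (flag Adj (S.filter (cell · ∈ π))) 2)
      (boundaries k (flag Adj (S.filter (cell · ∈ π))) 2) := by
  obtain ⟨i, j, hij, rfl⟩ := Finset.card_eq_two.1 hπ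
  obtain ⟨f, hf, h⟩ := exists_noCrossing (A := S.filter (cell · = i)) (B := S.filter (cell · = j))
    (fun v hv => (Finset.mem_filter.1 hv).2) (fun v hv => (Finset.mem_filter.1 hv).2)
  have hU : S.filter (cell · = i) ∪ S.filter (cell · = j) =
      S.filter (cell · ∈ ({i, j} : Finset (ℤ × ℤ))) := by
    rw [← Finset.filter_or]
    exact Finset.filter_congr fun v _ => by simp
  have := codimLE_of_noCrossing (k := k) (κ := cell) (r := Adj) (fun _ _ h => Adj.symm h)
    adj_of_cell_eq hf hij (fun v hv => (Finset.mem_filter.1 hv).2)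
    (fun v hv => (Finset.mem_filter.1 hv).2) h
  rw [hU] at this
  refine this.mono (Nat.mul_le_mul_left 3 (Finset.card_le_card ?_)) le_rfl le_rfl
  rw [← hU]
  exact Finset.subset_union_right

/-- Cells that are not near each other contribute nothing. -/
theorem codimLE_pair_of_not_near (S : Finset ℝ²) {π : Finset (ℤ × ℤ)} (hπ : π.card = 2)
    (hfar : ¬ ∀ i ∈ π, ∀ j ∈ π, j ∈ nearCells i) :
    CodimLE 0 (cycles k (flag Adj (S.filter (cell · ∈ π))) 2)
      (boundaries k (flag Adj (S.filter (cell · ∈ π))) 2) := by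
  refine CodimLE.of_le (fun z hz => ?_) 0
  obtain ⟨x, hx⟩ := exists_apex cell (S.filter (cell · ∈ π))
  have hz1 := hz.1
  rw [chains_succ] at hz1
  refine mem_boundaries_of_mono adj_of_cell_eq hx (Finsupp.supported_mono ?_ hz1) hz.2
  rintro σ ⟨hc, hσ⟩
  refine ⟨hc, hσ, mono_of_card_image_le ?_⟩
  have hsub : σ.image cell ⊆ π := by
    intro i hi
    obtain ⟨v, hv, rfl⟩ := Finset.mem_image.1 hi
    exact (Finset.mem_filter.1 (hσ.2.1 hv)).2
  have hne : σ.image cell ≠ π := by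
    rintro rfl
    refine hfar fun i hi j hj => ?_
    obtain ⟨u, hu, rfl⟩ := Finset.mem_image.1 hi
    obtain ⟨v, hv, rfl⟩ := Finset.mem_image.1 hj
    exact (hσ.2.2 u hu v hv).cell_mem
  have := Finset.card_lt_card (hsub.ssubset_of_ne hne)
  omega

/-- A point lies in boundedly many members of a family of sets of mutually near cells. -/
theorem sum_card_filter_cell_le (S : Finset ℝ²) (P : Finset (Finset (ℤ × ℤ)))
    (hP : ∀ π ∈ P, ∀ i ∈ π, ∀ j ∈ π, j ∈ nearCells i) :
    ∑ π ∈ P, (S.filter (cell · ∈ π)).card ≤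
      S.card * 2 ^ offsets.card := by
  have h1 : ∑ π ∈ P, (S.filter (cell · ∈ π)).card = ∑ v ∈ S, (P.filter (cell v ∈ ·)).card :=
    Finset.sum_card_bipartiteAbove_eq_sum_card_bipartiteBelow fun π v => cell v ∈ π
  rw [h1, ← smul_eq_mul]
  refine Finset.sum_le_card_nsmul S _ _ fun v _ => ?_
  have h2 : P.filter (cell v ∈ ·) ⊆ (nearCells (cell v)).powerset := by
    intro π hπ
    obtain ⟨hπ, hv⟩ := Finset.mem_filter.1 hπ
    exact Finset.mem_powerset.2 fun j hj => hP π hπ _ hv j hj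
  refine (Finset.card_le_card h2).trans ?_
  rw [Finset.card_powerset]
  exact Nat.pow_le_pow_right (by norm_num) (card_nearCells_le _)

/-- Representatives of the classes of the equivalence relation generated by `s`. -/
theorem exists_representatives {α : Type*} (s : α → α → Prop) (X : Finset α) :
    ∃ T ⊆ X, (∀ t ∈ T, ∀ t' ∈ T, Relation.EqvGen s t t' → t = t') ∧
      ∀ x ∈ X, ∃ t ∈ T, Relation.EqvGen s t x := by
  classical
  induction X using Finset.induction_on with
  | empty => exact ⟨∅, subset_rfl, by simp, by simp⟩
  | insert x X hx ih =>
    obtain ⟨T, hTX, hind, hrep⟩ := ih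
    by_cases h : ∃ t ∈ T, Relation.EqvGen s t x
    · refine ⟨T, hTX.trans (Finset.subset_insert x X), hind, fun y hy => ?_⟩
      rcases Finset.mem_insert.1 hy with rfl | hy
      · exact h
      · exact hrep y hy
    · push Not at h
      refine ⟨insert x T, Finset.insert_subset_insert x hTX, ?_, fun y hy => ?_⟩
      · intro t ht t' ht' heq
        rcases Finset.mem_insert.1 ht with h1 | h1 <;> rcases Finset.mem_insert.1 ht' with h2 | h2
        · rw [h1, h2]
        · exact (h t' h2 (h1 ▸ heq.symm)).elim
        · exact (h t h1 (h2 ▸ heq)).elim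
        · exact hind t h1 t' h2 heq
      · rcases Finset.mem_insert.1 hy with rfl | hy
        · exact ⟨y, Finset.mem_insert_self y T, .refl _⟩
        · obtain ⟨t, ht, hty⟩ := hrep y hy
          exact ⟨t, Finset.mem_insert_of_mem ht, hty⟩

/-- The classes of triangles and the pairs of near cells each contribute a bounded number for every
point of `S`. -/
theorem betti_ripsComplex_le (S : Finset ℝ²) : betti k (ripsComplex 1 S) 2 ≤
    4 * 2 ^ offsets.card * S.card := by
  classical
  rw [ripsComplex_eq_flag]
  set M := 2 ^ offsets.card
  obtain ⟨T, hTX, hind, hrep⟩ := exists_representatives (Swap (flag Adj S) cell 2)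
    (S.powerset.filter fun σ => σ ∈ flag Adj S ∧ σ.card = 3 ∧ Set.InjOn cell (σ : Set ℝ²))
  have hT : ∀ t ∈ T, t ∈ flag Adj S ∧ t.card = 3 ∧ (t.image cell).card = 3 := fun t ht => by
    obtain ⟨h1, h2, h3⟩ := (Finset.mem_filter.1 (hTX ht)).2
    exact ⟨h1, h2, (Finset.card_image_iff.2 h3).trans h2⟩
  have hcardT : T.card ≤ S.card * M := by
    rw [Finset.card_eq_sum_card_image (fun t => t.image cell) T]
    refine (Finset.sum_le_sum fun π hπ => ?_).trans
      (sum_card_filter_cell_le S (T.image fun t => t.image cell) ?_)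
    · obtain ⟨t, ht, rfl⟩ := Finset.mem_image.1 hπ
      refine card_le_of_inequivalent (hT t ht).2.2 (fun t' ht' => ?_) fun t₁ h₁ t₂ h₂ =>
        hind t₁ (Finset.mem_filter.1 h₁).1 t₂ (Finset.mem_filter.1 h₂).1
      obtain ⟨ht', him⟩ := Finset.mem_filter.1 ht'
      exact ⟨(hT t' ht').1, (hT t' ht').2.1, him⟩
    · intro π hπ i hi j hj
      obtain ⟨t, ht, rfl⟩ := Finset.mem_image.1 hπ
      obtain ⟨u, hu, rfl⟩ := Finset.mem_image.1 hi
      obtain ⟨v, hv, rfl⟩ := Finset.mem_image.1 hj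
      exact Adj.cell_mem ((hT t ht).1.2.2 u hu v hv)
  let near : Finset (ℤ × ℤ) → Prop := fun π => ∀ i ∈ π, ∀ j ∈ π, j ∈ nearCells i
  let N : Finset (ℤ × ℤ) → ℕ := fun π => if near π then 3 * (S.filter (cell · ∈ π)).card else 0
  have hcodim := codimLE_of_cells (k := k) adj_of_cell_eq S (T := T)
    (fun σ hσ hc hinj => hrep σ (Finset.mem_filter.2
      ⟨Finset.mem_powerset.2 hσ.2.1, hσ, hc, hinj⟩)) N fun π hπ => by
    have hπ2 := (Finset.mem_powersetCard.1 hπ).2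
    by_cases hnear : near π
    · simp only [N, if_pos hnear]
      exact codimLE_pair_of_cells k S hπ2
    · simp only [N, if_neg hnear]
      exact codimLE_pair_of_not_near k S hπ2 hnear
  have hsum : ∑ π ∈ (S.image cell).powersetCard 2, N π ≤ 3 * (S.card * M) := by
    rw [← Finset.sum_filter, ← Finset.mul_sum]
    exact Nat.mul_le_mul_left 3 (sum_card_filter_cell_le S _ fun π hπ =>
      (Finset.mem_filter.1 hπ).2)
  refine (betti_le_of_codimLE hcodim).trans ?_
  calc T.card + ∑ π ∈ (S.image cell).powersetCard 2, N π ≤ S.card * M + 3 * (S.card * M) :=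
        add_le_add hcardT hsum
    _ = 4 * M * S.card := by ring

end Cells

end RipsBetti

theorem mainTheorem2 :
    ∃ D : ℝ, ∀ (k : Type*) [Field k] (n : ℕ),
      (RipsBetti.maxBetti k 2 2 n : ℝ) ≤ D * n := by
  refine ⟨((4 * 2 ^ RipsBetti.offsets.card : ℕ) : ℝ), fun k _ n => ?_⟩
  obtain ⟨S, hS, hb⟩ := (RipsBetti.isGreatest_maxBetti k 2 2 n).1
  rw [hb]
  exact_mod_cast (RipsBetti.betti_ripsComplex_le k S).trans (Nat.mul_le_mul_left _ hS)
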